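/- Let $M$ be a connected (Hausdorff) smooth $3$-dimensional manifold with a smooth contact metric structure $(\eta,\xi,\varphi,g)$; that is, $g$ is a Riemannian metric, $\eta$ is a one-form such that $\eta\wedge d\eta$ vanishes nowhere, $\xi$ is a unit vector field, $\varphi$ is a field of endomorphisms of $TM$, and $$\eta(\xi)=1,\qquad \varphi^2=-\mathrm{Id}+\eta\otimes\xi,\qquad \varphi\xi=0,\qquad d\eta(X,Y)=2g(X,\varphi Y),$$ where $d\eta(X,Y)=X(\eta(Y))-Y(\eta(X))-\eta([X,Y])$. Let $h=\frac12 L_\xi\varphi$, let $\nabla$ be the Levi-Civita connection of $g$ and let $R(X,Y)Z=\nabla_X\nabla_YZ-\nabla_Y\nabla_XZ-\nabla_{[X,Y]}Z$. Suppose that for some functions $\kappa,\mu:M\to\mathbb R$ $$R(X,Y)\xi=\kappa\,(\eta(Y)X-\eta(X)Y)+\mu\,(\eta(Y)hX-\eta(X)hY)$$ for all tangent vectors $X,Y$. (1) If $\kappa<1$ everywhere on $M$, then $\kappa$ is constant if and only if $\mu$ is constant. (2) If $\mu=0$ identically on $M$, then $\kappa$ is constant. -/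

import Mathlib

open Bundle VectorField
open scoped Manifold ContDiff

noncomputable section

section General

variable {E : Type*} [NormedAddCommGroup E] [NormedSpace ℝ E]
  {H : Type*} [TopologicalSpace H] (I : ModelWithCorners ℝ E H)
  {M : Type*} [TopologicalSpace M] [ChartedSpace H M]

/-- `X` is a smooth vector field on `M`. -/
def IsSmoothVectorField [IsManifold I ∞ M] (X : Π x : M, TangentSpace I x) : Prop :=
  ContMDiff I I.tangent ∞ (fun x ↦ (⟨x, X x⟩ : TangentBundle I M))

/-- `η` is a smooth one-form on `M`, i.e. a smooth section of the cotangent bundle. -/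
def IsSmoothOneForm [IsManifold I ∞ M] (η : Π x : M, TangentSpace I x →L[ℝ] ℝ) : Prop :=
  ContMDiff I (I.prod 𝓘(ℝ, E →L[ℝ] ℝ)) ∞
    (fun x ↦ TotalSpace.mk' (E →L[ℝ] ℝ) (E := fun x : M ↦ TangentSpace I x →L[ℝ] ℝ) x (η x))

/-- `φ` is a smooth field of endomorphisms of the tangent bundle of `M`. -/
def IsSmoothEndomorphismField [IsManifold I ∞ M]
    (φ : Π x : M, TangentSpace I x →L[ℝ] TangentSpace I x) : Prop :=
  ContMDiff I (I.prod 𝓘(ℝ, E →L[ℝ] E)) ∞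
    (fun x ↦ TotalSpace.mk' (E →L[ℝ] E)
      (E := fun x : M ↦ TangentSpace I x →L[ℝ] TangentSpace I x) x (φ x))

/-- The derivative `X(f) = df(X)` of a real function along a vector field. -/
def derivAlong (X : Π x : M, TangentSpace I x) (f : M → ℝ) (x : M) : ℝ :=
  mvfderiv I f x (X x)

/-- The exterior derivative of a one-form, evaluated on vector fields:
`dη(X, Y) = X(η(Y)) - Y(η(X)) - η([X, Y])` (no factor `1/2`). -/
def oneFormExtDeriv (η : Π x : M, TangentSpace I x →L[ℝ] ℝ)
    (X Y : Π x : M, TangentSpace I x) (x : M) : ℝ :=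
  derivAlong I X (fun y ↦ η y (Y y)) x - derivAlong I Y (fun y ↦ η y (X y)) x
    - η x (mlieBracket I X Y x)

/-- The three-form `η ∧ dη`, evaluated on vector fields. -/
def wedgeExtDeriv (η : Π x : M, TangentSpace I x →L[ℝ] ℝ)
    (X Y Z : Π x : M, TangentSpace I x) (x : M) : ℝ :=
  η x (X x) * oneFormExtDeriv I η Y Z x + η x (Y x) * oneFormExtDeriv I η Z X x
    + η x (Z x) * oneFormExtDeriv I η X Y x

/-- The Lie derivative `L_Z φ` of an endomorphism field, evaluated on vector fields:
`(L_Z φ)(X) = [Z, φX] - φ[Z, X]`. -/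
def endomorphismLieDeriv (Z : Π x : M, TangentSpace I x)
    (φ : Π x : M, TangentSpace I x →L[ℝ] TangentSpace I x)
    (X : Π x : M, TangentSpace I x) (x : M) : TangentSpace I x :=
  mlieBracket I Z (fun y ↦ φ y (X y)) x - φ x (mlieBracket I Z X x)

end General

section Connection

variable {E : Type*} [NormedAddCommGroup E] [NormedSpace ℝ E] [FiniteDimensional ℝ E]
  {H : Type*} [TopologicalSpace H] {I : ModelWithCorners ℝ E H}
  {M : Type*} [TopologicalSpace M] [ChartedSpace H M] [IsManifold I ∞ M]

/-- The curvature `R(X, Y)Z = ∇_X ∇_Y Z - ∇_Y ∇_X Z - ∇_{[X, Y]} Z` of a connection on the tangent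
bundle (recall that `nabla Z x (X x)` is `(∇_X Z)(x)`). -/
def curvature (nabla : CovariantDerivative I E (TangentSpace I : M → Type _))
    (X Y Z : Π x : M, TangentSpace I x) (x : M) : TangentSpace I x :=
  nabla (fun y ↦ nabla Z y (Y y)) x (X x) - nabla (fun y ↦ nabla Z y (X y)) x (Y x)
    - nabla Z x (mlieBracket I X Y x)

variable [RiemannianBundle (fun x : M ↦ TangentSpace I x)]
  [IsContMDiffRiemannianBundle I ∞ E (fun x : M ↦ TangentSpace I x)]

/-- `nabla` is the Levi-Civita connection of the Riemannian metric of `M`: the smooth connection on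
the tangent bundle that is torsion-free and compatible with the metric. -/
structure IsLeviCivita
    (nabla : CovariantDerivative I E (TangentSpace I : M → Type _)) : Prop where
  smooth : CovariantDerivative.ContMDiffCovariantDerivative nabla ∞
  torsion_free : nabla.torsion = 0
  metric :
    haveI : IsContMDiffRiemannianBundle I 1 E (fun x : M ↦ TangentSpace I x) :=
      .of_le (n := ∞) (by simp)
    nabla.IsMetricCompatible

end Connection

section ContactMetric

variable (M : Type*) [TopologicalSpace M] [ChartedSpace (EuclideanSpace ℝ (Fin 3)) M]
  [IsManifold (𝓡 3) ∞ M]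
  [RiemannianBundle (fun x : M ↦ TangentSpace (𝓡 3) x)]

/-- A contact metric structure `(η, ξ, φ, g)` on a three-dimensional manifold `M`, where `g` is the
Riemannian metric carried by `M`. -/
structure ContactMetricStructure where
  /-- the contact form -/
  η : Π x : M, TangentSpace (𝓡 3) x →L[ℝ] ℝ
  /-- the Reeb field -/
  ξ : Π x : M, TangentSpace (𝓡 3) x
  /-- the endomorphism field of the tangent bundle -/
  φ : Π x : M, TangentSpace (𝓡 3) x →L[ℝ] TangentSpace (𝓡 3) x
  smooth_η : IsSmoothOneForm (𝓡 3) η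
  smooth_ξ : IsSmoothVectorField (𝓡 3) ξ
  smooth_φ : IsSmoothEndomorphismField (𝓡 3) φ
  /-- `η ∧ dη` is a volume form -/
  contact : ∀ X Y Z : (Π x : M, TangentSpace (𝓡 3) x),
    IsSmoothVectorField (𝓡 3) X → IsSmoothVectorField (𝓡 3) Y → IsSmoothVectorField (𝓡 3) Z →
    ∀ x, LinearIndependent ℝ ![X x, Y x, Z x] → wedgeExtDeriv (𝓡 3) η X Y Z x ≠ 0
  /-- `ξ` is a unit vector field -/
  norm_ξ : ∀ x, inner ℝ (ξ x) (ξ x) = 1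
  η_ξ : ∀ x, η x (ξ x) = 1
  φ_φ : ∀ x (v : TangentSpace (𝓡 3) x), φ x (φ x v) = -v + η x v • ξ x
  φ_ξ : ∀ x, φ x (ξ x) = 0
  /-- `dη(X, Y) = 2 g(X, φY)` -/
  extDeriv_η : ∀ X Y : (Π x : M, TangentSpace (𝓡 3) x),
    IsSmoothVectorField (𝓡 3) X → IsSmoothVectorField (𝓡 3) Y →
    ∀ x, oneFormExtDeriv (𝓡 3) η X Y x = 2 * inner ℝ (X x) (φ x (Y x))

variable {M}

/-- The tensor field `h = ½ L_ξ φ` of a contact metric structure, evaluated on vector fields. -/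
def ContactMetricStructure.h (S : ContactMetricStructure M)
    (X : Π x : M, TangentSpace (𝓡 3) x) (x : M) : TangentSpace (𝓡 3) x :=
  (1 / 2 : ℝ) • endomorphismLieDeriv (𝓡 3) S.ξ S.φ X x

/-- A contact metric structure is a `(κ, μ)`-structure, for given functions `κ` and `μ`, if the
curvature tensor `R` of the Levi-Civita connection satisfies
`R(X, Y)ξ = κ (η(Y)X - η(X)Y) + μ (η(Y)hX - η(X)hY)`. -/
def ContactMetricStructure.IsKappaMu (S : ContactMetricStructure M)
    (nabla : CovariantDerivative (𝓡 3) (EuclideanSpace ℝ (Fin 3))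
      (TangentSpace (𝓡 3) : M → Type _)) (κ μ : M → ℝ) : Prop :=
  ∀ X Y : (Π x : M, TangentSpace (𝓡 3) x),
    IsSmoothVectorField (𝓡 3) X → IsSmoothVectorField (𝓡 3) Y →
    ∀ x, curvature nabla X Y S.ξ x =
      κ x • (S.η x (Y x) • X x - S.η x (X x) • Y x)
        + μ x • (S.η x (Y x) • S.h X x - S.η x (X x) • S.h Y x)

end ContactMetric

end

open Filter Topology

/-! ### Calculus of smooth vector fields: derivations, brackets, extension by bump functions. -/

section SmoothFields

variable {E : Type*} [NormedAddCommGroup E] [NormedSpace ℝ E]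
  {H : Type*} [TopologicalSpace H] {I : ModelWithCorners ℝ E H}
  {M : Type*} [TopologicalSpace M] [ChartedSpace H M]
  {X Y Z W V : Π x : M, TangentSpace I x} {f g k : M → ℝ} {x : M}

/-! The proof is a moving-frame computation. Near any point there is an orthonormal frame e, f = φe,
ξ, and metric compatibility leaves few connection coefficients: ∇_eξ = pe + qf, ∇_fξ = re + sf, ∇_ξe
= af, while b and c are the horizontal parts of ∇_ee and ∇_ff. The contact condition gives r = q + 2
and the Jacobi identity s = -p, so h is trace-free and symmetric with h² = p² + (q+1)² on the plane
orthogonal to ξ. The curvature hypothesis then gives κ = 1 - p² - (q+1)² (`κ_eq`); in particular κ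
is continuous and at most 1.

Where κ < 1 the eigenvalues of h are distinct, so the frame can be rotated smoothly to make p = 0
and q + 1 ≠ 0 (`exists_eigenframe`). In such a frame (`eigenframe_relations`) the curvature and
Jacobi identities reduce to μ = -2a, ξq = 0, ea = -eq and fa = fq. Hence a and q control each other.
If κ is constant, so is q, whence ea = fa = 0, and [e,f] = -be + cf + 2ξ forces ξa = 0: μ is locally
constant. If μ is constant, so is a, all derivatives of q vanish, and κ is locally constant.

Connectedness globalises both statements. From μ to κ no bound on κ is needed: if κ < 1 at some
point, the level set of κ through it is open and closed; otherwise κ = 1 everywhere. This one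
argument (`exists_κ_eq`) gives part (2) and half of part (1). -/

theorem derivAlong_congr (h : f =ᶠ[𝓝 x] g) : derivAlong I X f x = derivAlong I X g x :=
  congrArg (fun L : E →L[ℝ] ℝ ↦ L (X x)) h.mfderiv_eq

theorem derivAlong_eq_zero_of_eventually_eq_const {c : ℝ} (h : ∀ᶠ y in 𝓝 x, f y = c) :
    derivAlong I X f x = 0 := by
  have h' : f =ᶠ[𝓝 x] fun _ ↦ c := h
  rw [derivAlong_congr h', derivAlong, mvfderiv_const]
  rfl

theorem derivAlong_fun_add (hf : MDiffAt f x) (hg : MDiffAt g x) :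
    derivAlong I X (fun y ↦ f y + g y) x = derivAlong I X f x + derivAlong I X g x := by
  simp [derivAlong, mvfderiv_fun_add hf hg]

theorem derivAlong_fun_mul (hf : MDiffAt f x) (hg : MDiffAt g x) :
    derivAlong I X (fun y ↦ f y * g y) x = f x * derivAlong I X g x + g x * derivAlong I X f x := by
  simp [derivAlong, mvfderiv_fun_mul hf hg]

theorem derivAlong_fun_neg :
    derivAlong I X (fun y ↦ -f y) x = -derivAlong I X f x := by
  simp [derivAlong, mvfderiv_fun_neg]

/-- The derivative of a polynomial `a + b f + c f ^ 2` in a function `f`. -/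
theorem derivAlong_quadratic (hf : MDiffAt f x) (a b c : ℝ) :
    derivAlong I X (fun y ↦ a + b * f y + c * (f y * f y)) x
      = (b + 2 * c * f x) * derivAlong I X f x := by
  have hc (r : ℝ) : MDiffAt (fun _ : M ↦ r) x := mdifferentiableAt_const
  have h0 (r : ℝ) : derivAlong I X (fun _ : M ↦ r) x = 0 :=
    derivAlong_eq_zero_of_eventually_eq_const (c := r) (by simp)
  have h1 : MDiffAt (fun y ↦ b * f y) x := (hc b).mul hf
  have h2 : MDiffAt (fun y ↦ f y * f y) x := hf.mul hf
  have h3 : MDiffAt (fun y ↦ c * (f y * f y)) x := (hc c).mul h2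
  have h4 : MDiffAt (fun y ↦ a + b * f y) x := (hc a).add h1
  rw [derivAlong_fun_add h4 h3, derivAlong_fun_add (hc a) h1,
    derivAlong_fun_mul (hc b) hf, derivAlong_fun_mul (hc c) h2, derivAlong_fun_mul hf hf]
  simp only [h0]
  ring

theorem derivAlong_linearCombination {a b c : ℝ}
    (h : W x = a • X x + b • Y x + c • Z x) :
    derivAlong I W f x = a * derivAlong I X f x + b * derivAlong I Y f x
      + c * derivAlong I Z f x := by
  simp [derivAlong, h]

theorem mdifferentiableAt_of_contMDiff (hf : ContMDiff I 𝓘(ℝ) ∞ f) (x : M) : MDiffAt f x :=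
  (hf x).mdifferentiableAt (by simp)

section Bracket

variable [IsManifold I ∞ M]

theorem IsSmoothVectorField.mdifferentiableAt (hX : IsSmoothVectorField I X) (x : M) :
    MDiffAt (T% X) x :=
  (hX x).mdifferentiableAt (by simp)

theorem IsSmoothVectorField.add (hX : IsSmoothVectorField I X) (hY : IsSmoothVectorField I Y) :
    IsSmoothVectorField I (X + Y) :=
  ContMDiff.add_section hX hY

theorem IsSmoothVectorField.smul (hf : ContMDiff I 𝓘(ℝ) ∞ f) (hX : IsSmoothVectorField I X) :
    IsSmoothVectorField I (f • X) :=
  ContMDiff.smul_section hf hX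

theorem IsSmoothVectorField.apply {φ : Π x : M, TangentSpace I x →L[ℝ] TangentSpace I x}
    (hφ : IsSmoothEndomorphismField I φ) (hX : IsSmoothVectorField I X) :
    IsSmoothVectorField I (fun y ↦ φ y (X y)) :=
  ContMDiff.clm_bundle_apply (F₁ := E) (F₂ := E) (b := id) hφ hX

theorem isManifold_minSmoothness (n : ℕ) : IsManifold I (minSmoothness ℝ n) M := by
  rw [minSmoothness_of_isRCLikeNormedField]
  exact IsManifold.of_le (n := ∞) (by exact_mod_cast le_top)

theorem IsSmoothVectorField.mlieBracket [CompleteSpace E]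
    (hX : IsSmoothVectorField I X) (hY : IsSmoothVectorField I Y) :
    IsSmoothVectorField I (mlieBracket I X Y) := by
  have : IsManifold I ((⊤ : ℕ∞) + 1) M := by simpa using ‹IsManifold I ∞ M›
  have : IsManifold I (minSmoothness ℝ 2) M := isManifold_minSmoothness 2
  exact ContDiff.mlieBracket_vectorField (n := (⊤ : ℕ∞)) (m := (⊤ : ℕ∞)) hX hY (by simp)

theorem ContMDiff.derivAlong (hf : ContMDiff I 𝓘(ℝ) ∞ f) (hX : IsSmoothVectorField I X) :
    ContMDiff I 𝓘(ℝ) ∞ (derivAlong I X f) := by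
  have h1 : ContMDiff I 𝓘(ℝ).tangent ∞
      (fun y ↦ tangentMap I 𝓘(ℝ) f (⟨y, X y⟩ : TangentBundle I M)) :=
    (hf.contMDiff_tangentMap (m := ∞) (by simp)).comp hX
  exact (contMDiff_snd_tangentBundle_modelSpace ℝ 𝓘(ℝ)).comp h1

/-- The Jacobi identity for smooth vector fields. -/
theorem IsSmoothVectorField.jacobi [CompleteSpace E] (hX : IsSmoothVectorField I X)
    (hY : IsSmoothVectorField I Y) (hZ : IsSmoothVectorField I Z) (x : M) :
    VectorField.mlieBracket I X (VectorField.mlieBracket I Y Z) x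
      = VectorField.mlieBracket I (VectorField.mlieBracket I X Y) Z x
        + VectorField.mlieBracket I Y (VectorField.mlieBracket I X Z) x := by
  have : IsManifold I (minSmoothness ℝ 3) M := isManifold_minSmoothness 3
  have h : minSmoothness ℝ 2 ≤ ∞ := by
    rw [minSmoothness_of_isRCLikeNormedField]
    exact ENat.LEInfty.out
  exact leibniz_identity_mlieBracket_apply ((hX x).of_le h) ((hY x).of_le h) ((hZ x).of_le h)

/-- The bracket with a field that is near `x` a combination of three fields. -/
theorem mlieBracket_linearCombination [CompleteSpace E]
    (hX : IsSmoothVectorField I X) (hY : IsSmoothVectorField I Y) (hZ : IsSmoothVectorField I Z)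
    (hf : ContMDiff I 𝓘(ℝ) ∞ f) (hg : ContMDiff I 𝓘(ℝ) ∞ g) (hk : ContMDiff I 𝓘(ℝ) ∞ k)
    (h : ∀ᶠ y in 𝓝 x, W y = f y • X y + g y • Y y + k y • Z y) :
    mlieBracket I V W x =
      (derivAlong I V f x • X x + f x • mlieBracket I V X x)
      + (derivAlong I V g x • Y x + g x • mlieBracket I V Y x)
      + (derivAlong I V k x • Z x + k x • mlieBracket I V Z x) := by
  have : IsManifold I (minSmoothness ℝ 2) M := isManifold_minSmoothness 2
  have hW : W =ᶠ[𝓝 x] f • X + g • Y + k • Z := h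
  rw [EventuallyEq.rfl.mlieBracket_vectorField_eq hW]
  rw [mlieBracket_add_right (((hX.smul hf).add (hY.smul hg)).mdifferentiableAt x)
    ((hZ.smul hk).mdifferentiableAt x),
    mlieBracket_add_right ((hX.smul hf).mdifferentiableAt x) ((hY.smul hg).mdifferentiableAt x),
    mlieBracket_smul_right ((hf x).mdifferentiableAt (by simp)) (hX.mdifferentiableAt x),
    mlieBracket_smul_right ((hg x).mdifferentiableAt (by simp)) (hY.mdifferentiableAt x),
    mlieBracket_smul_right ((hk x).mdifferentiableAt (by simp)) (hZ.mdifferentiableAt x)]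
  rfl

/-- A bracket of vector fields acts on functions as the commutator of derivations, at every point
where some smooth vector field does not vanish. -/
theorem derivAlong_mlieBracket [CompleteSpace E] (hX : IsSmoothVectorField I X)
    (hY : IsSmoothVectorField I Y) (hZ : IsSmoothVectorField I Z) (hZx : Z x ≠ 0)
    (hf : ContMDiff I 𝓘(ℝ) ∞ f) :
    derivAlong I (VectorField.mlieBracket I X Y) f x
      = derivAlong I X (derivAlong I Y f) x - derivAlong I Y (derivAlong I X f) x := by
  have : IsManifold I (minSmoothness ℝ 2) M := isManifold_minSmoothness 2
  have key {V W : Π x : M, TangentSpace I x} {k : M → ℝ} (y : M) (hW : IsSmoothVectorField I W)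
      (hk : ContMDiff I 𝓘(ℝ) ∞ k) : VectorField.mlieBracket I V (k • W) y
        = derivAlong I V k y • W y + k y • VectorField.mlieBracket I V W y :=
    mlieBracket_smul_right ((hk y).mdifferentiableAt (by simp)) (hW.mdifferentiableAt y)
  have key2 {V V' : Π x : M, TangentSpace I x} (hV' : IsSmoothVectorField I V') :
      VectorField.mlieBracket I V (VectorField.mlieBracket I V' (f • Z)) x
        = derivAlong I V (derivAlong I V' f) x • Z x
          + derivAlong I V' f x • VectorField.mlieBracket I V Z x
          + (derivAlong I V f x • VectorField.mlieBracket I V' Z x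
            + f x • VectorField.mlieBracket I V (VectorField.mlieBracket I V' Z) x) := by
    have e : VectorField.mlieBracket I V' (f • Z)
        = (derivAlong I V' f) • Z + f • VectorField.mlieBracket I V' Z := by
      funext y
      exact key y hZ hf
    have s1 := hZ.smul (hf.derivAlong hV')
    have s2 := (hV'.mlieBracket hZ).smul hf
    rw [e, mlieBracket_add_right (s1.mdifferentiableAt x) (s2.mdifferentiableAt x),
      key x hZ (hf.derivAlong hV'), key x (hV'.mlieBracket hZ) hf]
  -- The Jacobi identity for X, Y, fZ, expanded by the Leibniz rule: all terms cancel except those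
  -- multiplying Z, and Z does not vanish at the point.
  have J := hX.jacobi hY (hZ.smul hf) x
  rw [key2 hY, key2 hX, key x hZ hf, hX.jacobi hY hZ x] at J
  have J' : (derivAlong I (VectorField.mlieBracket I X Y) f x
      - (derivAlong I X (derivAlong I Y f) x - derivAlong I Y (derivAlong I X f) x)) • Z x = 0 := by
    rw [← sub_eq_zero] at J
    rw [← neg_eq_zero, ← J]
    module
  exact sub_eq_zero.1 ((smul_eq_zero.1 J').resolve_right hZx)

/-- A vector field that is smooth on an open set coincides near each point of this set with a
globally smooth one. -/
theorem exists_isSmoothVectorField_eventuallyEq [FiniteDimensional ℝ E] [T2Space M] {U : Set M}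
    (hU : IsOpen U) (hx : x ∈ U)
    (hX : ContMDiffOn I I.tangent ∞ (fun y ↦ (⟨y, X y⟩ : TangentBundle I M)) U) :
    ∃ Y : Π x : M, TangentSpace I x, IsSmoothVectorField I Y ∧ ∀ᶠ y in 𝓝 x, Y y = X y := by
  obtain ⟨ψ, -, hψ⟩ := (SmoothBumpFunction.nhds_basis_tsupport (I := I) x).mem_iff.1
    (hU.mem_nhds hx)
  refine ⟨(ψ : M → ℝ) • X, fun y ↦ ?_, ?_⟩
  · by_cases hy : y ∈ tsupport ψ
    · have h1 : ContMDiffAt I I.tangent ∞ (fun y ↦ (⟨y, X y⟩ : TangentBundle I M)) y :=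
        hX.contMDiffAt (hU.mem_nhds (hψ hy))
      exact ContMDiffAt.smul_section ψ.contMDiff.contMDiffAt h1
    · have h0 : ContMDiffAt I I.tangent ∞
          (fun y ↦ (⟨y, (0 : TangentSpace I y)⟩ : TangentBundle I M)) y :=
        Bundle.contMDiff_zeroSection ℝ (TangentSpace I) y
      refine h0.congr_of_eventuallyEq ?_
      filter_upwards [(isClosed_tsupport ψ).isOpen_compl.mem_nhds hy] with z hz
      simp [image_eq_zero_of_notMem_tsupport hz]
  · filter_upwards [ψ.eventuallyEq_one] with y hy
    simp [hy]

/-- Every tangent vector is the value of a smooth vector field. -/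
theorem exists_isSmoothVectorField_apply_eq [FiniteDimensional ℝ E] [T2Space M]
    (v : TangentSpace I x) :
    ∃ Y : Π x : M, TangentSpace I x, IsSmoothVectorField I Y ∧ Y x = v := by
  obtain ⟨s, hs, hsv⟩ := FiberBundle.exists_contMDiffOn_extend (k := ∞) I E v
  obtain ⟨U, hUs, hU, hxU⟩ := mem_nhds_iff.1 hs
  obtain ⟨Y, hY, hYx⟩ := exists_isSmoothVectorField_eventuallyEq hU hxU (hsv.mono hUs)
  exact ⟨Y, hY, by simpa using hYx.self_of_nhds⟩

end Bracket

end SmoothFields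

/-! ### Covariant derivatives and the Levi-Civita connection. -/

section LeviCivita

variable {E : Type*} [NormedAddCommGroup E] [NormedSpace ℝ E] [FiniteDimensional ℝ E]
  {H : Type*} [TopologicalSpace H] {I : ModelWithCorners ℝ E H}
  {M : Type*} [TopologicalSpace M] [ChartedSpace H M] [IsManifold I ∞ M]
  {nabla : CovariantDerivative I E (TangentSpace I : M → Type _)}
  {X Y Z W : Π x : M, TangentSpace I x} {f g k : M → ℝ} {x : M}

omit [FiniteDimensional ℝ E] in
theorem covariantDerivative_congr (hX : IsSmoothVectorField I X) (h : ∀ᶠ y in 𝓝 x, W y = X y) :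
    nabla W x = nabla X x := by
  have hW : MDiffAt (T% W) x := (hX.mdifferentiableAt x).congr_of_eventuallyEq
    (h.mono fun y hy ↦ by simp [hy])
  exact nabla.isCovariantDerivativeOn.congr_of_eventuallyEq hW (hX.mdifferentiableAt x)
    univ_mem h

omit [FiniteDimensional ℝ E] in
/-- The covariant derivative of a field that is near `x` a combination of three fields. -/
theorem covariantDerivative_linearCombination
    (hX : IsSmoothVectorField I X) (hY : IsSmoothVectorField I Y) (hZ : IsSmoothVectorField I Z)
    (hf : ContMDiff I 𝓘(ℝ) ∞ f) (hg : ContMDiff I 𝓘(ℝ) ∞ g) (hk : ContMDiff I 𝓘(ℝ) ∞ k)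
    (h : ∀ᶠ y in 𝓝 x, W y = f y • X y + g y • Y y + k y • Z y) (V : Π x : M, TangentSpace I x) :
    nabla W x (V x) =
      (derivAlong I V f x • X x + f x • nabla X x (V x))
      + (derivAlong I V g x • Y x + g x • nabla Y x (V x))
      + (derivAlong I V k x • Z x + k x • nabla Z x (V x)) := by
  have hXY := (hX.smul hf).add (hY.smul hg)
  have hn := nabla.isCovariantDerivativeOn (s := Set.univ)
  rw [covariantDerivative_congr (hXY.add (hZ.smul hk)) h,
    hn.add (hXY.mdifferentiableAt x) ((hZ.smul hk).mdifferentiableAt x),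
    hn.add ((hX.smul hf).mdifferentiableAt x) ((hY.smul hg).mdifferentiableAt x),
    hn.leibniz (hX.mdifferentiableAt x) ((hf x).mdifferentiableAt (by simp)),
    hn.leibniz (hY.mdifferentiableAt x) ((hg x).mdifferentiableAt (by simp)),
    hn.leibniz (hZ.mdifferentiableAt x) ((hk x).mdifferentiableAt (by simp))]
  simp only [derivAlong, add_apply, smul_apply,
    ContinuousLinearMap.smulRight_apply]
  module

variable [RiemannianBundle (fun x : M ↦ TangentSpace I x)]
  [IsContMDiffRiemannianBundle I ∞ E (fun x : M ↦ TangentSpace I x)]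

omit [FiniteDimensional ℝ E] in
theorem IsSmoothVectorField.inner (hX : IsSmoothVectorField I X) (hY : IsSmoothVectorField I Y) :
    ContMDiff I 𝓘(ℝ) ∞ (fun y ↦ inner ℝ (X y) (Y y)) :=
  ContMDiff.inner_bundle (F := E) (b := id) hX hY

namespace IsLeviCivita

theorem isSmoothVectorField (h : IsLeviCivita nabla) (hX : IsSmoothVectorField I X)
    (hY : IsSmoothVectorField I Y) : IsSmoothVectorField I (fun y ↦ nabla Y y (X y)) := by
  have h1 := h.smooth.contMDiff.contMDiff (σ := Y) (by simpa using hY.contMDiffOn)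
  exact ContMDiff.clm_bundle_apply (F₁ := E) (F₂ := E) (b := id) (contMDiffOn_univ.1 h1) hX

theorem mlieBracket_eq (h : IsLeviCivita nabla) (hX : IsSmoothVectorField I X)
    (hY : IsSmoothVectorField I Y) (x : M) :
    mlieBracket I X Y x = nabla Y x (X x) - nabla X x (Y x) :=
  ((CovariantDerivative.torsion_eq_zero_iff nabla).1 h.torsion_free
    (hX.mdifferentiableAt x) (hY.mdifferentiableAt x)).symm

theorem derivAlong_inner (h : IsLeviCivita nabla) (hY : IsSmoothVectorField I Y)
    (hZ : IsSmoothVectorField I Z) (X : Π x : M, TangentSpace I x) (x : M) :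
    derivAlong I X (fun y ↦ inner ℝ (Y y) (Z y)) x
      = inner ℝ (nabla Y x (X x)) (Z x) + inner ℝ (Y x) (nabla Z x (X x)) := by
  have : IsContMDiffRiemannianBundle I 1 E (fun x : M ↦ TangentSpace I x) :=
    .of_le (n := ∞) (by simp)
  exact h.metric.mvfderiv_inner_eq X (hY.mdifferentiableAt x) (hZ.mdifferentiableAt x)

/-- Metric compatibility for fields whose inner product is locally constant. -/
theorem inner_left_eq_neg (h : IsLeviCivita nabla) (hY : IsSmoothVectorField I Y)
    (hZ : IsSmoothVectorField I Z) {c : ℝ} (hc : ∀ᶠ y in 𝓝 x, inner ℝ (Y y) (Z y) = c)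
    (X : Π x : M, TangentSpace I x) :
    inner ℝ (nabla Y x (X x)) (Z x) = -inner ℝ (nabla Z x (X x)) (Y x) := by
  have h1 := h.derivAlong_inner hY hZ X x
  rw [derivAlong_eq_zero_of_eventually_eq_const hc, real_inner_comm (nabla Z x (X x))] at h1
  linarith

end IsLeviCivita

end LeviCivita

/-! ### Tensor identities of a contact metric structure and the covariant derivative of ξ. -/

namespace ContactMetricStructure

variable {M : Type*} [TopologicalSpace M] [T2Space M]
    [ChartedSpace (EuclideanSpace ℝ (Fin 3)) M] [IsManifold (𝓡 3) ∞ M]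
    [RiemannianBundle (fun x : M ↦ TangentSpace (𝓡 3) x)]
    (S : ContactMetricStructure M) {x : M}

/-- Antisymmetry of dη passes to φ; both vectors are extended to smooth fields so that dη can be
evaluated on them. -/
theorem inner_φ_right (v w : TangentSpace (𝓡 3) x) :
    inner ℝ v (S.φ x w) = -inner ℝ (S.φ x v) w := by
  obtain ⟨X, hX, rfl⟩ := exists_isSmoothVectorField_apply_eq v
  obtain ⟨Y, hY, rfl⟩ := exists_isSmoothVectorField_apply_eq w
  have h1 := S.extDeriv_η X Y hX hY x
  have h2 := S.extDeriv_η Y X hY hX x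
  have h3 : oneFormExtDeriv (𝓡 3) S.η Y X x = -oneFormExtDeriv (𝓡 3) S.η X Y x := by
    rw [oneFormExtDeriv, oneFormExtDeriv, mlieBracket_swap_apply (V := Y), map_neg]
    ring
  rw [real_inner_comm] at h2
  linarith

omit [T2Space M] in
-- Computing φ³v in two ways leaves η(φv)ξ = 0.
theorem η_φ (v : TangentSpace (𝓡 3) x) : S.η x (S.φ x v) = 0 := by
  have h1 := S.φ_φ x (S.φ x v)
  rw [S.φ_φ x v, map_add, map_neg, map_smul, S.φ_ξ, smul_zero, add_zero] at h1
  have h2 : S.η x (S.φ x v) • S.ξ x = 0 := by simpa using h1.symm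
  have h3 : S.ξ x ≠ 0 := fun h ↦ by simpa [h] using S.norm_ξ x
  exact (smul_eq_zero.1 h2).resolve_right h3

/-- Skewness of φ applied to φv and ξ gives g(φ²v, ξ) = 0, because φξ = 0; expanding φ² yields the
claim. -/
theorem η_eq_inner (v : TangentSpace (𝓡 3) x) : S.η x v = inner ℝ (S.ξ x) v := by
  have h1 := S.inner_φ_right (S.φ x v) (S.ξ x)
  rw [S.φ_ξ, S.φ_φ, inner_zero_right, inner_add_left, inner_neg_left, real_inner_smul_left,
    S.norm_ξ, real_inner_comm] at h1
  linarith

theorem inner_φ_φ (v w : TangentSpace (𝓡 3) x) :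
    inner ℝ (S.φ x v) (S.φ x w) = inner ℝ v w - S.η x v * S.η x w := by
  have h1 := S.inner_φ_right v (S.φ x w)
  rw [S.φ_φ, inner_add_right, inner_neg_right, real_inner_smul_right,
    real_inner_comm (S.ξ x) v, ← S.η_eq_inner] at h1
  linarith

variable [IsContMDiffRiemannianBundle (𝓡 3) ∞ (EuclideanSpace ℝ (Fin 3))
      (fun x : M ↦ TangentSpace (𝓡 3) x)]
    {nabla : CovariantDerivative (𝓡 3) (EuclideanSpace ℝ (Fin 3))
      (TangentSpace (𝓡 3) : M → Type _)}

theorem inner_nabla_ξ_ξ (hn : IsLeviCivita nabla) (v : TangentSpace (𝓡 3) x) :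
    inner ℝ (nabla S.ξ x v) (S.ξ x) = 0 := by
  obtain ⟨X, hX, rfl⟩ := exists_isSmoothVectorField_apply_eq v
  have h := hn.inner_left_eq_neg (x := x) S.smooth_ξ S.smooth_ξ (c := 1)
    (.of_forall S.norm_ξ) X
  linarith

/-- The skew part of the covariant derivative of the Reeb field. -/
theorem inner_nabla_ξ_sub (hn : IsLeviCivita nabla) (v w : TangentSpace (𝓡 3) x) :
    inner ℝ (nabla S.ξ x v) w - inner ℝ (nabla S.ξ x w) v = 2 * inner ℝ v (S.φ x w) := by
  obtain ⟨X, hX, rfl⟩ := exists_isSmoothVectorField_apply_eq v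
  obtain ⟨Y, hY, rfl⟩ := exists_isSmoothVectorField_apply_eq w
  rw [← S.extDeriv_η X Y hX hY x, oneFormExtDeriv]
  simp only [S.η_eq_inner]
  rw [hn.derivAlong_inner S.smooth_ξ hY, hn.derivAlong_inner S.smooth_ξ hX,
    hn.mlieBracket_eq hX hY, inner_sub_right]
  ring

/-- Since ξ has unit length, ∇ξ takes values orthogonal to ξ; its skew part is g(·, φ·), which
vanishes against ξ. So the integral curves of ξ are geodesics. -/
theorem nabla_ξ_ξ (hn : IsLeviCivita nabla) (x : M) : nabla S.ξ x (S.ξ x) = 0 := by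
  refine ext_inner_right ℝ fun w ↦ ?_
  have h := S.inner_nabla_ξ_sub hn (S.ξ x) w
  rw [S.inner_nabla_ξ_ξ hn, ← S.η_eq_inner, S.η_φ] at h
  rw [inner_zero_left]
  linarith

end ContactMetricStructure

/-! ### Adapted orthonormal frames and their connection coefficients. -/

namespace ContactMetricStructure

section AdaptedFrame

variable {M : Type*} [TopologicalSpace M] [ChartedSpace (EuclideanSpace ℝ (Fin 3)) M]
  [IsManifold (𝓡 3) ∞ M] [RiemannianBundle (fun x : M ↦ TangentSpace (𝓡 3) x)]

/-- The smooth fields `e`, `f = φ e` and the Reeb field form an orthonormal frame on the open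
set `U`. -/
structure IsAdaptedFrame (S : ContactMetricStructure M) (e f : Π x : M, TangentSpace (𝓡 3) x)
    (U : Set M) : Prop where
  isOpen : IsOpen U
  smooth : IsSmoothVectorField (𝓡 3) e
  φ_left : ∀ y, S.φ y (e y) = f y
  inner_self : ∀ y ∈ U, inner ℝ (e y) (e y) = 1
  inner_ξ : ∀ y ∈ U, inner ℝ (S.ξ y) (e y) = 0

/-- An adapted frame with its connection coefficients. -/
structure IsAdaptedFrameWith (S : ContactMetricStructure M)
    (nabla : CovariantDerivative (𝓡 3) (EuclideanSpace ℝ (Fin 3))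
      (TangentSpace (𝓡 3) : M → Type _))
    (e f : Π x : M, TangentSpace (𝓡 3) x) (U : Set M) (a b c p q r s : M → ℝ) : Prop
    extends IsAdaptedFrame S e f U where
  smooth_a : ContMDiff (𝓡 3) 𝓘(ℝ) ∞ a
  smooth_b : ContMDiff (𝓡 3) 𝓘(ℝ) ∞ b
  smooth_c : ContMDiff (𝓡 3) 𝓘(ℝ) ∞ c
  smooth_p : ContMDiff (𝓡 3) 𝓘(ℝ) ∞ p
  smooth_q : ContMDiff (𝓡 3) 𝓘(ℝ) ∞ q
  smooth_r : ContMDiff (𝓡 3) 𝓘(ℝ) ∞ r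
  smooth_s : ContMDiff (𝓡 3) 𝓘(ℝ) ∞ s
  r_eq : ∀ y ∈ U, r y = q y + 2
  nabla_ξ_e : ∀ y ∈ U, nabla S.ξ y (e y) = p y • e y + q y • f y
  nabla_ξ_f : ∀ y ∈ U, nabla S.ξ y (f y) = r y • e y + s y • f y
  nabla_e_e : ∀ y ∈ U, nabla e y (e y) = b y • f y - p y • S.ξ y
  nabla_e_f : ∀ y ∈ U, nabla e y (f y) = -c y • f y - r y • S.ξ y
  nabla_e_ξ : ∀ y ∈ U, nabla e y (S.ξ y) = a y • f y
  nabla_f_e : ∀ y ∈ U, nabla f y (e y) = -b y • e y - q y • S.ξ y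
  nabla_f_f : ∀ y ∈ U, nabla f y (f y) = c y • e y - s y • S.ξ y
  nabla_f_ξ : ∀ y ∈ U, nabla f y (S.ξ y) = -a y • e y

end AdaptedFrame

variable {M : Type*} [TopologicalSpace M] [T2Space M]
  [ChartedSpace (EuclideanSpace ℝ (Fin 3)) M] [IsManifold (𝓡 3) ∞ M]
  [RiemannianBundle (fun x : M ↦ TangentSpace (𝓡 3) x)]
  {S : ContactMetricStructure M} {e f : Π x : M, TangentSpace (𝓡 3) x} {U : Set M} {y : M}

namespace IsAdaptedFrame

omit [T2Space M] in
theorem smooth_right (F : S.IsAdaptedFrame e f U) : IsSmoothVectorField (𝓡 3) f := by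
  have h := F.smooth.apply S.smooth_φ
  rwa [funext F.φ_left] at h

theorem φ_right (F : S.IsAdaptedFrame e f U) (hy : y ∈ U) : S.φ y (f y) = -e y := by
  rw [← F.φ_left, S.φ_φ, S.η_eq_inner, F.inner_ξ y hy, zero_smul, add_zero]

theorem inner_ξ_right (F : S.IsAdaptedFrame e f U) (y : M) : inner ℝ (S.ξ y) (f y) = 0 := by
  rw [← F.φ_left, ← S.η_eq_inner, S.η_φ]

theorem inner_left_right (F : S.IsAdaptedFrame e f U) (y : M) : inner ℝ (e y) (f y) = 0 := by
  have h := S.inner_φ_right (e y) (e y)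
  rw [F.φ_left, real_inner_comm (e y)] at h
  linarith

theorem inner_right (F : S.IsAdaptedFrame e f U) (hy : y ∈ U) : inner ℝ (f y) (f y) = 1 := by
  rw [← F.φ_left, S.inner_φ_φ, S.η_eq_inner, F.inner_ξ y hy, F.inner_self y hy]
  simp

theorem expand (F : S.IsAdaptedFrame e f U) (hy : y ∈ U) (v : TangentSpace (𝓡 3) y) :
    v = inner ℝ v (e y) • e y + inner ℝ v (f y) • f y + inner ℝ v (S.ξ y) • S.ξ y := by
  have ho : Orthonormal ℝ ![e y, f y, S.ξ y] := by
    rw [orthonormal_iff_ite]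
    intro i j
    fin_cases i <;> fin_cases j <;>
      simp [-inner_self_eq_norm_sq_to_K, F.inner_self y hy, F.inner_right hy, S.norm_ξ y,
        F.inner_left_right y, F.inner_ξ y hy, F.inner_ξ_right y, real_inner_comm (e y) (f y),
        real_inner_comm (S.ξ y) (f y), real_inner_comm (S.ξ y) (e y)]
  have hfin : Module.finrank ℝ (TangentSpace (𝓡 3) y) = 3 :=
    (finrank_euclideanSpace_fin : Module.finrank ℝ (EuclideanSpace ℝ (Fin 3)) = 3)
  have hspan : ⊤ ≤ Submodule.span ℝ (Set.range ![e y, f y, S.ξ y]) :=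
    (ho.linearIndependent.span_eq_top_of_card_eq_finrank (by simp [hfin])).ge
  have h := (OrthonormalBasis.mk ho hspan).sum_repr' v
  rw [Fin.sum_univ_three] at h
  simp only [OrthonormalBasis.coe_mk, Matrix.cons_val_zero, Matrix.cons_val_one,
    Matrix.cons_val] at h
  rw [real_inner_comm v (e y), real_inner_comm v (f y), real_inner_comm v (S.ξ y)] at h
  exact h.symm

theorem coeff_eq (F : S.IsAdaptedFrame e f U) (hy : y ∈ U) {a b c a' b' c' : ℝ}
    (h : a • e y + b • f y + c • S.ξ y = a' • e y + b' • f y + c' • S.ξ y) :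
    a = a' ∧ b = b' ∧ c = c' := by
  have h1 := congrArg (fun v ↦ inner ℝ (e y) v) h
  have h2 := congrArg (fun v ↦ inner ℝ (f y) v) h
  have h3 := congrArg (fun v ↦ inner ℝ (S.ξ y) v) h
  simp only [inner_add_right, real_inner_smul_right, F.inner_self y hy, F.inner_right hy,
    S.norm_ξ y, F.inner_left_right y, F.inner_ξ y hy, F.inner_ξ_right y,
    real_inner_comm (e y) (f y), real_inner_comm (S.ξ y) (f y),
    real_inner_comm (S.ξ y) (e y)] at h1 h2 h3
  exact ⟨by linarith, by linarith, by linarith⟩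

theorem mvfderiv_eq_zero (F : S.IsAdaptedFrame e f U) {g : M → ℝ} (hy : y ∈ U)
    (he : derivAlong (𝓡 3) e g y = 0) (hf : derivAlong (𝓡 3) f g y = 0)
    (hξ : derivAlong (𝓡 3) S.ξ g y = 0) : mvfderiv (𝓡 3) g y = 0 := by
  ext v
  rw [F.expand hy v]
  simp only [derivAlong] at he hf hξ
  simp only [map_add, map_smul, he, hf, hξ]
  simp

variable [IsContMDiffRiemannianBundle (𝓡 3) ∞ (EuclideanSpace ℝ (Fin 3))
    (fun x : M ↦ TangentSpace (𝓡 3) x)]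
  {nabla : CovariantDerivative (𝓡 3) (EuclideanSpace ℝ (Fin 3))
    (TangentSpace (𝓡 3) : M → Type _)}

/-- The inner products of frame fields are constant on U, so the connection matrix is skew; together
with ∇_ξξ = 0 this leaves the seven coefficients. -/
theorem isAdaptedFrameWith (F : S.IsAdaptedFrame e f U) (hn : IsLeviCivita nabla) :
    S.IsAdaptedFrameWith nabla e f U (fun y ↦ inner ℝ (nabla e y (S.ξ y)) (f y))
      (fun y ↦ inner ℝ (nabla e y (e y)) (f y)) (fun y ↦ inner ℝ (nabla f y (f y)) (e y))
      (fun y ↦ inner ℝ (nabla S.ξ y (e y)) (e y)) (fun y ↦ inner ℝ (nabla S.ξ y (e y)) (f y))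
      (fun y ↦ inner ℝ (nabla S.ξ y (f y)) (e y))
      (fun y ↦ inner ℝ (nabla S.ξ y (f y)) (f y)) := by
  have hf := F.smooth_right
  have hev {y : M} (hy : y ∈ U) : ∀ᶠ z in 𝓝 y, z ∈ U := F.isOpen.mem_nhds hy
  have ee {y : M} (hy : y ∈ U) (X : Π x : M, TangentSpace (𝓡 3) x) :
      inner ℝ (nabla e y (X y)) (e y) = 0 := by
    have h := hn.inner_left_eq_neg (x := y) F.smooth F.smooth (c := 1)
      ((hev hy).mono F.inner_self) X
    linarith
  have ff {y : M} (hy : y ∈ U) (X : Π x : M, TangentSpace (𝓡 3) x) :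
      inner ℝ (nabla f y (X y)) (f y) = 0 := by
    have h := hn.inner_left_eq_neg (x := y) hf hf (c := 1)
      ((hev hy).mono fun z hz ↦ F.inner_right hz) X
    linarith
  have ef {y : M} (X : Π x : M, TangentSpace (𝓡 3) x) :
      inner ℝ (nabla e y (X y)) (f y) = -inner ℝ (nabla f y (X y)) (e y) :=
    hn.inner_left_eq_neg (x := y) F.smooth hf (c := 0) (.of_forall F.inner_left_right) X
  have eξ {y : M} (hy : y ∈ U) (X : Π x : M, TangentSpace (𝓡 3) x) :
      inner ℝ (nabla e y (X y)) (S.ξ y) = -inner ℝ (nabla S.ξ y (X y)) (e y) := by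
    refine hn.inner_left_eq_neg (x := y) F.smooth S.smooth_ξ (c := 0) ?_ X
    exact (hev hy).mono fun z hz ↦ by rw [real_inner_comm, F.inner_ξ z hz]
  have fξ {y : M} (X : Π x : M, TangentSpace (𝓡 3) x) :
      inner ℝ (nabla f y (X y)) (S.ξ y) = -inner ℝ (nabla S.ξ y (X y)) (f y) := by
    refine hn.inner_left_eq_neg (x := y) hf S.smooth_ξ (c := 0) (.of_forall fun z ↦ ?_) X
    rw [real_inner_comm, F.inner_ξ_right z]
  refine { F with
    smooth_a := (hn.isSmoothVectorField S.smooth_ξ F.smooth).inner hf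
    smooth_b := (hn.isSmoothVectorField F.smooth F.smooth).inner hf
    smooth_c := (hn.isSmoothVectorField hf hf).inner F.smooth
    smooth_p := (hn.isSmoothVectorField F.smooth S.smooth_ξ).inner F.smooth
    smooth_q := (hn.isSmoothVectorField F.smooth S.smooth_ξ).inner hf
    smooth_r := (hn.isSmoothVectorField hf S.smooth_ξ).inner F.smooth
    smooth_s := (hn.isSmoothVectorField hf S.smooth_ξ).inner hf
    r_eq := fun y hy ↦ ?_
    nabla_ξ_e := fun y hy ↦ ?_
    nabla_ξ_f := fun y hy ↦ ?_
    nabla_e_e := fun y hy ↦ ?_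
    nabla_e_f := fun y hy ↦ ?_
    nabla_e_ξ := fun y hy ↦ ?_
    nabla_f_e := fun y hy ↦ ?_
    nabla_f_f := fun y hy ↦ ?_
    nabla_f_ξ := fun y hy ↦ ?_ }
  -- The skew part of ∇ξ gives q - r = 2g(e, φf) = -2.
  · have h := S.inner_nabla_ξ_sub hn (e y) (f y)
    rw [F.φ_right hy, inner_neg_right, F.inner_self y hy] at h
    linarith
  · conv_lhs => rw [F.expand hy (nabla S.ξ y (e y)), S.inner_nabla_ξ_ξ hn]
    module
  · conv_lhs => rw [F.expand hy (nabla S.ξ y (f y)), S.inner_nabla_ξ_ξ hn]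
    module
  · conv_lhs => rw [F.expand hy (nabla e y (e y)), ee hy e, eξ hy e]
    module
  · conv_lhs => rw [F.expand hy (nabla e y (f y)), ee hy f, eξ hy f, ef f]
    module
  · conv_lhs => rw [F.expand hy (nabla e y (S.ξ y)), ee hy S.ξ, eξ hy S.ξ, S.nabla_ξ_ξ hn,
      inner_zero_left]
    module
  · conv_lhs => rw [F.expand hy (nabla f y (e y)), ff hy e, fξ e]
    simp only [ef e]
    module
  · conv_lhs => rw [F.expand hy (nabla f y (f y)), ff hy f, fξ f]
    module
  · conv_lhs => rw [F.expand hy (nabla f y (S.ξ y)), ff hy S.ξ, fξ S.ξ, S.nabla_ξ_ξ hn,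
      inner_zero_left]
    simp only [ef S.ξ]
    module

end IsAdaptedFrame

end ContactMetricStructure

/-! ### Structure equations: brackets, Jacobi identity, the tensor h, curvature. -/

namespace ContactMetricStructure

namespace IsAdaptedFrameWith

variable {M : Type*} [TopologicalSpace M] [T2Space M]
  [ChartedSpace (EuclideanSpace ℝ (Fin 3)) M] [IsManifold (𝓡 3) ∞ M]
  [RiemannianBundle (fun x : M ↦ TangentSpace (𝓡 3) x)]
  [IsContMDiffRiemannianBundle (𝓡 3) ∞ (EuclideanSpace ℝ (Fin 3))
    (fun x : M ↦ TangentSpace (𝓡 3) x)]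
  {S : ContactMetricStructure M} {e f : Π x : M, TangentSpace (𝓡 3) x} {U : Set M} {y : M}
  {nabla : CovariantDerivative (𝓡 3) (EuclideanSpace ℝ (Fin 3))
    (TangentSpace (𝓡 3) : M → Type _)}
  {a b c p q r s κ μ g : M → ℝ}

omit [T2Space M] [IsContMDiffRiemannianBundle (𝓡 3) ∞ (EuclideanSpace ℝ (Fin 3))
    (fun x : M ↦ TangentSpace (𝓡 3) x)] in
theorem eventually_mem (F : S.IsAdaptedFrameWith nabla e f U a b c p q r s) (hy : y ∈ U) :
    ∀ᶠ z in 𝓝 y, z ∈ U :=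
  F.isOpen.mem_nhds hy

omit [T2Space M] in
theorem mlieBracket_e_ξ (F : S.IsAdaptedFrameWith nabla e f U a b c p q r s)
    (hn : IsLeviCivita nabla) (hy : y ∈ U) :
    mlieBracket (𝓡 3) e S.ξ y = p y • e y + (q y - a y) • f y + (0 : ℝ) • S.ξ y := by
  rw [hn.mlieBracket_eq F.smooth S.smooth_ξ, F.nabla_ξ_e y hy, F.nabla_e_ξ y hy]
  module

omit [T2Space M] in
theorem mlieBracket_f_ξ (F : S.IsAdaptedFrameWith nabla e f U a b c p q r s)
    (hn : IsLeviCivita nabla) (hy : y ∈ U) :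
    mlieBracket (𝓡 3) f S.ξ y = (r y + a y) • e y + s y • f y + (0 : ℝ) • S.ξ y := by
  rw [hn.mlieBracket_eq F.smooth_right S.smooth_ξ, F.nabla_ξ_f y hy, F.nabla_f_ξ y hy]
  module

omit [T2Space M] in
theorem mlieBracket_e_f (F : S.IsAdaptedFrameWith nabla e f U a b c p q r s)
    (hn : IsLeviCivita nabla) (hy : y ∈ U) :
    mlieBracket (𝓡 3) e f y = -b y • e y + c y • f y + (2 : ℝ) • S.ξ y := by
  rw [hn.mlieBracket_eq F.smooth F.smooth_right, F.nabla_e_f y hy, F.nabla_f_e y hy, F.r_eq y hy]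
  module

omit [T2Space M] in
/-- Commuting derivatives along the frame. -/
theorem derivAlong_comm_e_ξ (F : S.IsAdaptedFrameWith nabla e f U a b c p q r s)
    (hn : IsLeviCivita nabla) (hg : ContMDiff (𝓡 3) 𝓘(ℝ) ∞ g) (hy : y ∈ U) :
    derivAlong (𝓡 3) e (derivAlong (𝓡 3) S.ξ g) y - derivAlong (𝓡 3) S.ξ (derivAlong (𝓡 3) e g) y
      = p y * derivAlong (𝓡 3) e g y + (q y - a y) * derivAlong (𝓡 3) f g y := by
  have h0 : S.ξ y ≠ 0 := fun h ↦ by simpa [h] using S.norm_ξ y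
  rw [← derivAlong_mlieBracket F.smooth S.smooth_ξ S.smooth_ξ h0 hg,
    derivAlong_linearCombination (F.mlieBracket_e_ξ hn hy)]
  ring

omit [T2Space M] in
theorem derivAlong_comm_f_ξ (F : S.IsAdaptedFrameWith nabla e f U a b c p q r s)
    (hn : IsLeviCivita nabla) (hg : ContMDiff (𝓡 3) 𝓘(ℝ) ∞ g) (hy : y ∈ U) :
    derivAlong (𝓡 3) f (derivAlong (𝓡 3) S.ξ g) y - derivAlong (𝓡 3) S.ξ (derivAlong (𝓡 3) f g) y
      = (r y + a y) * derivAlong (𝓡 3) e g y + s y * derivAlong (𝓡 3) f g y := by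
  have h0 : S.ξ y ≠ 0 := fun h ↦ by simpa [h] using S.norm_ξ y
  rw [← derivAlong_mlieBracket F.smooth_right S.smooth_ξ S.smooth_ξ h0 hg,
    derivAlong_linearCombination (F.mlieBracket_f_ξ hn hy)]
  ring

omit [T2Space M] in
theorem derivAlong_comm_e_f (F : S.IsAdaptedFrameWith nabla e f U a b c p q r s)
    (hn : IsLeviCivita nabla) (hg : ContMDiff (𝓡 3) 𝓘(ℝ) ∞ g) (hy : y ∈ U) :
    derivAlong (𝓡 3) e (derivAlong (𝓡 3) f g) y - derivAlong (𝓡 3) f (derivAlong (𝓡 3) e g) y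
      = -b y * derivAlong (𝓡 3) e g y + c y * derivAlong (𝓡 3) f g y
        + 2 * derivAlong (𝓡 3) S.ξ g y := by
  have h0 : S.ξ y ≠ 0 := fun h ↦ by simpa [h] using S.norm_ξ y
  rw [← derivAlong_mlieBracket F.smooth F.smooth_right S.smooth_ξ h0 hg,
    derivAlong_linearCombination (F.mlieBracket_e_f hn hy)]

omit [T2Space M] [IsContMDiffRiemannianBundle (𝓡 3) ∞ (EuclideanSpace ℝ (Fin 3))
    (fun x : M ↦ TangentSpace (𝓡 3) x)] in
theorem derivAlong_r (F : S.IsAdaptedFrameWith nabla e f U a b c p q r s) (hy : y ∈ U)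
    (X : Π x : M, TangentSpace (𝓡 3) x) :
    derivAlong (𝓡 3) X r y = derivAlong (𝓡 3) X q y := by
  have h : r =ᶠ[𝓝 y] fun z ↦ q z + 2 := (F.eventually_mem hy).mono F.r_eq
  rw [derivAlong_congr h, derivAlong_fun_add (mdifferentiableAt_of_contMDiff F.smooth_q y)
    mdifferentiableAt_const,
    derivAlong_eq_zero_of_eventually_eq_const (f := fun _ ↦ (2 : ℝ)) (c := 2) (by simp), add_zero]

/-- The Jacobi identity for the frame. -/
theorem jacobi (F : S.IsAdaptedFrameWith nabla e f U a b c p q r s)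
    (hn : IsLeviCivita nabla) (hy : y ∈ U) :
    derivAlong (𝓡 3) e q y + derivAlong (𝓡 3) e a y - s y * b y
        = derivAlong (𝓡 3) S.ξ b y + c y * (r y + a y) + derivAlong (𝓡 3) f p y ∧
      derivAlong (𝓡 3) e s y
        = -derivAlong (𝓡 3) S.ξ c y - b y * (q y - a y) + derivAlong (𝓡 3) f q y
          - derivAlong (𝓡 3) f a y - p y * c y ∧
      s y = -p y := by
  have hf := F.smooth_right
  have h0 : ContMDiff (𝓡 3) 𝓘(ℝ) ∞ (fun _ : M ↦ (0 : ℝ)) := contMDiff_const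
  have h2 : ContMDiff (𝓡 3) 𝓘(ℝ) ∞ (fun _ : M ↦ (2 : ℝ)) := contMDiff_const
  have d0 (t : ℝ) (X : Π x : M, TangentSpace (𝓡 3) x) :
      derivAlong (𝓡 3) X (fun _ : M ↦ t) y = 0 :=
    derivAlong_eq_zero_of_eventually_eq_const (c := t) (by simp)
  have D {k : M → ℝ} (hk : ContMDiff (𝓡 3) 𝓘(ℝ) ∞ k) := mdifferentiableAt_of_contMDiff hk y
  have e1 := mlieBracket_linearCombination (V := e) (x := y) F.smooth hf S.smooth_ξ
    (F.smooth_r.add F.smooth_a) F.smooth_s h0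
    ((F.eventually_mem hy).mono fun z hz ↦ F.mlieBracket_f_ξ hn hz)
  have e2 := mlieBracket_linearCombination (V := S.ξ) (x := y) F.smooth hf S.smooth_ξ
    F.smooth_b.neg F.smooth_c h2
    ((F.eventually_mem hy).mono fun z hz ↦ F.mlieBracket_e_f hn hz)
  have e3 := mlieBracket_linearCombination (V := f) (x := y) F.smooth hf S.smooth_ξ
    F.smooth_p (F.smooth_q.sub F.smooth_a) h0
    ((F.eventually_mem hy).mono fun z hz ↦ F.mlieBracket_e_ξ hn hz)
  have J := F.smooth.jacobi hf S.smooth_ξ y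
  have dr : derivAlong (𝓡 3) e (r + a) y
      = derivAlong (𝓡 3) e q y + derivAlong (𝓡 3) e a y :=
    (derivAlong_fun_add (D F.smooth_r) (D F.smooth_a)).trans (by rw [F.derivAlong_r hy])
  have dq : derivAlong (𝓡 3) f (fun z ↦ q z - a z) y
      = derivAlong (𝓡 3) f q y - derivAlong (𝓡 3) f a y := by
    simp only [sub_eq_add_neg]
    rw [derivAlong_fun_add (D F.smooth_q) (D F.smooth_a.neg), derivAlong_fun_neg]
  rw [e1, mlieBracket_swap_apply (V := mlieBracket (𝓡 3) e f), e2, e3,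
    mlieBracket_swap_apply (V := S.ξ) (W := e), mlieBracket_swap_apply (V := S.ξ) (W := f),
    mlieBracket_swap_apply (V := f) (W := e), F.mlieBracket_e_ξ hn hy, F.mlieBracket_f_ξ hn hy,
    F.mlieBracket_e_f hn hy, dr, dq, derivAlong_fun_neg, d0, d0, d0] at J
  simp only [mlieBracket_self, Pi.zero_apply, Pi.add_apply] at J
  have J' : (derivAlong (𝓡 3) e q y + derivAlong (𝓡 3) e a y - s y * b y) • e y
      + (derivAlong (𝓡 3) e s y + s y * c y) • f y + (2 * s y) • S.ξ y
      = (derivAlong (𝓡 3) S.ξ b y - b y * p y + c y * (r y + a y) + derivAlong (𝓡 3) f p y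
          + p y * b y) • e y
        + (-derivAlong (𝓡 3) S.ξ c y - b y * (q y - a y) + c y * s y + derivAlong (𝓡 3) f q y
          - derivAlong (𝓡 3) f a y - p y * c y) • f y + (-2 * p y) • S.ξ y := by
    rw [← sub_eq_zero] at J ⊢
    rw [← J]
    module
  -- The ξ-component is 2s = -2p, because only [e,f] has a ξ-part, with constant coefficient 2. This
  -- relation also cancels the products pb and sc in the other components.
  obtain ⟨j1, j2, j3⟩ := F.coeff_eq hy J'
  exact ⟨by linarith, by linarith, by linarith⟩

/-- Together with `h_f`: in the basis e, f the matrix of h is symmetric and trace-free, so p = 0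
says exactly that e and f are eigenvectors. -/
theorem h_e (F : S.IsAdaptedFrameWith nabla e f U a b c p q r s)
    (hn : IsLeviCivita nabla) (hy : y ∈ U) :
    S.h e y = -(q y + 1) • e y + p y • f y := by
  obtain ⟨-, -, hs⟩ := F.jacobi hn hy
  rw [ContactMetricStructure.h, endomorphismLieDeriv, funext F.φ_left,
    mlieBracket_swap_apply (V := S.ξ), mlieBracket_swap_apply (V := S.ξ),
    F.mlieBracket_e_ξ hn hy, F.mlieBracket_f_ξ hn hy]
  simp only [map_neg, map_add, map_smul, F.φ_left, F.φ_right hy, S.φ_ξ, hs, F.r_eq y hy]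
  module

theorem h_f (F : S.IsAdaptedFrameWith nabla e f U a b c p q r s)
    (hn : IsLeviCivita nabla) (hy : y ∈ U) :
    S.h f y = p y • e y + (q y + 1) • f y := by
  obtain ⟨-, -, hs⟩ := F.jacobi hn hy
  have h0 (t : ℝ) : ContMDiff (𝓡 3) 𝓘(ℝ) ∞ (fun _ : M ↦ t) := contMDiff_const
  have d0 (t : ℝ) (X : Π x : M, TangentSpace (𝓡 3) x) :
      derivAlong (𝓡 3) X (fun _ : M ↦ t) y = 0 :=
    derivAlong_eq_zero_of_eventually_eq_const (c := t) (by simp)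
  -- The identity φf = -e holds only on U, hence the detour through a combination with constant
  -- coefficients -1, 0, 0 valid near y.
  have e1 := mlieBracket_linearCombination (V := S.ξ) (W := fun z ↦ S.φ z (f z)) (x := y)
    F.smooth F.smooth_right S.smooth_ξ (h0 (-1)) (h0 0) (h0 0)
    ((F.eventually_mem hy).mono fun z hz ↦ by rw [F.φ_right hz]; module)
  rw [ContactMetricStructure.h, endomorphismLieDeriv, e1,
    mlieBracket_swap_apply (V := S.ξ) (W := e), mlieBracket_swap_apply (V := S.ξ) (W := f),
    F.mlieBracket_e_ξ hn hy, F.mlieBracket_f_ξ hn hy]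
  simp only [map_neg, map_add, map_smul, F.φ_left, F.φ_right hy, S.φ_ξ, hs, F.r_eq y hy, d0,
    mlieBracket_self, Pi.zero_apply]
  module

section Curvature

omit [T2Space M] [IsContMDiffRiemannianBundle (𝓡 3) ∞ (EuclideanSpace ℝ (Fin 3))
    (fun x : M ↦ TangentSpace (𝓡 3) x)] in
theorem nabla_nabla_ξ_e (F : S.IsAdaptedFrameWith nabla e f U a b c p q r s) (hy : y ∈ U)
    (V : Π x : M, TangentSpace (𝓡 3) x) :
    nabla (fun z ↦ nabla S.ξ z (e z)) y (V y) =
      (derivAlong (𝓡 3) V p y • e y + p y • nabla e y (V y))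
      + (derivAlong (𝓡 3) V q y • f y + q y • nabla f y (V y)) := by
  have h0 : ContMDiff (𝓡 3) 𝓘(ℝ) ∞ (fun _ : M ↦ (0 : ℝ)) := contMDiff_const
  have d0 : derivAlong (𝓡 3) V (fun _ : M ↦ (0 : ℝ)) y = 0 :=
    derivAlong_eq_zero_of_eventually_eq_const (c := 0) (by simp)
  rw [covariantDerivative_linearCombination (x := y) F.smooth F.smooth_right S.smooth_ξ
    F.smooth_p F.smooth_q h0 ((F.eventually_mem hy).mono fun z hz ↦ by
      rw [F.nabla_ξ_e z hz, zero_smul, add_zero]) V, d0]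
  module

omit [T2Space M] [IsContMDiffRiemannianBundle (𝓡 3) ∞ (EuclideanSpace ℝ (Fin 3))
    (fun x : M ↦ TangentSpace (𝓡 3) x)] in
theorem nabla_nabla_ξ_f (F : S.IsAdaptedFrameWith nabla e f U a b c p q r s) (hy : y ∈ U)
    (V : Π x : M, TangentSpace (𝓡 3) x) :
    nabla (fun z ↦ nabla S.ξ z (f z)) y (V y) =
      (derivAlong (𝓡 3) V r y • e y + r y • nabla e y (V y))
      + (derivAlong (𝓡 3) V s y • f y + s y • nabla f y (V y)) := by
  have h0 : ContMDiff (𝓡 3) 𝓘(ℝ) ∞ (fun _ : M ↦ (0 : ℝ)) := contMDiff_const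
  have d0 : derivAlong (𝓡 3) V (fun _ : M ↦ (0 : ℝ)) y = 0 :=
    derivAlong_eq_zero_of_eventually_eq_const (c := 0) (by simp)
  rw [covariantDerivative_linearCombination (x := y) F.smooth F.smooth_right S.smooth_ξ
    F.smooth_r F.smooth_s h0 ((F.eventually_mem hy).mono fun z hz ↦ by
      rw [F.nabla_ξ_f z hz, zero_smul, add_zero]) V, d0]
  module

theorem nabla_nabla_ξ_ξ (hn : IsLeviCivita nabla) (v : TangentSpace (𝓡 3) y) :
    nabla (fun z ↦ nabla S.ξ z (S.ξ z)) y v = 0 := by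
  have h : (fun z ↦ nabla S.ξ z (S.ξ z)) = 0 := funext fun z ↦ S.nabla_ξ_ξ hn z
  rw [h, nabla.zero]
  rfl

theorem curvature_e_ξ (F : S.IsAdaptedFrameWith nabla e f U a b c p q r s)
    (hn : IsLeviCivita nabla) (hS : S.IsKappaMu nabla κ μ) (hy : y ∈ U) :
    -derivAlong (𝓡 3) S.ξ p y + q y * a y - p y * p y - (q y - a y) * r y
        = κ y - μ y * (q y + 1) ∧
      -derivAlong (𝓡 3) S.ξ q y - p y * a y - p y * q y - (q y - a y) * s y = μ y * p y := by
  have R := hS e S.ξ F.smooth S.smooth_ξ y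
  rw [curvature, nabla_nabla_ξ_ξ hn, F.nabla_nabla_ξ_e hy, F.mlieBracket_e_ξ hn hy, F.h_e hn hy,
    S.η_ξ, S.η_eq_inner (e y), F.inner_ξ y hy] at R
  simp only [map_add, map_smul, F.nabla_ξ_e y hy, F.nabla_ξ_f y hy, F.nabla_e_ξ y hy,
    F.nabla_f_ξ y hy, S.nabla_ξ_ξ hn y] at R
  obtain ⟨h1, h2, -⟩ := F.coeff_eq hy (a := -derivAlong (𝓡 3) S.ξ p y + q y * a y - p y * p y
    - (q y - a y) * r y) (a' := κ y - μ y * (q y + 1)) (b := -derivAlong (𝓡 3) S.ξ q y - p y * a y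
    - p y * q y - (q y - a y) * s y) (b' := μ y * p y) (c := 0) (c' := 0) (by
      rw [← sub_eq_zero] at R ⊢
      rw [← R]
      module)
  exact ⟨h1, h2⟩

/-- Only the f-component is kept: given s = -p and r = q + 2, the e-component repeats the second
equation of `curvature_e_ξ`. -/
theorem curvature_f_ξ (F : S.IsAdaptedFrameWith nabla e f U a b c p q r s)
    (hn : IsLeviCivita nabla) (hS : S.IsKappaMu nabla κ μ) (hy : y ∈ U) :
    -derivAlong (𝓡 3) S.ξ s y - r y * a y - (r y + a y) * q y - s y * s y
        = κ y + μ y * (q y + 1) := by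
  have R := hS f S.ξ F.smooth_right S.smooth_ξ y
  rw [curvature, nabla_nabla_ξ_ξ hn, F.nabla_nabla_ξ_f hy, F.mlieBracket_f_ξ hn hy, F.h_f hn hy,
    S.η_ξ, S.η_eq_inner (f y), F.inner_ξ_right y] at R
  simp only [map_add, map_smul, F.nabla_ξ_e y hy, F.nabla_ξ_f y hy, F.nabla_e_ξ y hy,
    F.nabla_f_ξ y hy, S.nabla_ξ_ξ hn y] at R
  exact (F.coeff_eq hy (a := -derivAlong (𝓡 3) S.ξ r y + s y * a y - (r y + a y) * p y
    - s y * r y) (a' := μ y * p y) (b := -derivAlong (𝓡 3) S.ξ s y - r y * a y - (r y + a y) * q y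
    - s y * s y) (b' := κ y + μ y * (q y + 1)) (c := 0) (c' := 0) (by
      rw [← sub_eq_zero] at R ⊢
      rw [← R]
      module)).2.1

/-- Codazzi-type equations: e and f are orthogonal to ξ, so the prescribed curvature R(e,f)ξ is
zero. They express eq and fq through b and c in an eigenframe. -/
theorem curvature_e_f (F : S.IsAdaptedFrameWith nabla e f U a b c p q r s)
    (hn : IsLeviCivita nabla) (hS : S.IsKappaMu nabla κ μ) (hy : y ∈ U) :
    derivAlong (𝓡 3) e q y - s y * b y - derivAlong (𝓡 3) f p y - q y * c y + b y * p y
        - c y * r y = 0 ∧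
      r y * b y + derivAlong (𝓡 3) e s y + p y * c y - derivAlong (𝓡 3) f q y + b y * q y
        - c y * s y = 0 := by
  have R := hS e f F.smooth F.smooth_right y
  rw [curvature, F.nabla_nabla_ξ_e hy, F.nabla_nabla_ξ_f hy, F.mlieBracket_e_f hn hy,
    S.η_eq_inner (f y), F.inner_ξ_right y, S.η_eq_inner (e y), F.inner_ξ y hy,
    F.derivAlong_r hy] at R
  simp only [map_add, map_smul, F.nabla_ξ_e y hy, F.nabla_ξ_f y hy, F.nabla_e_e y hy,
    F.nabla_e_f y hy, F.nabla_f_e y hy, F.nabla_f_f y hy, S.nabla_ξ_ξ hn y] at R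
  obtain ⟨h1, h2, -⟩ := F.coeff_eq hy (a := derivAlong (𝓡 3) e q y - s y * b y
    - derivAlong (𝓡 3) f p y - q y * c y + b y * p y - c y * r y) (a' := 0)
    (b := r y * b y + derivAlong (𝓡 3) e s y + p y * c y - derivAlong (𝓡 3) f q y + b y * q y
    - c y * s y) (b' := 0) (c := 0) (c' := 0) (by
      rw [← sub_eq_zero] at R ⊢
      rw [← R]
      module)
  exact ⟨h1, h2⟩

end Curvature

end IsAdaptedFrameWith

end ContactMetricStructure

/-! ### Local constancy of κ and μ in an eigenframe of h. -/

/-- A function whose derivative vanishes on an open set is locally constant there. -/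
theorem eventually_eq_of_mvfderiv_eq_zero {E : Type*} [NormedAddCommGroup E] [NormedSpace ℝ E]
    {H : Type*} [TopologicalSpace H] {I : ModelWithCorners ℝ E H} [I.Boundaryless]
    {M : Type*} [TopologicalSpace M] [ChartedSpace H M] [IsManifold I 1 M] {g : M → ℝ} {U : Set M}
    {x : M} (hU : IsOpen U) (hx : x ∈ U) (hg : ∀ y ∈ U, MDifferentiableAt I 𝓘(ℝ) g y)
    (h : ∀ y ∈ U, mvfderiv I g y = 0) : ∀ᶠ y in 𝓝 x, g y = g x := by
  set ψ := extChartAt I x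
  have hopen : IsOpen (ψ.target ∩ ψ.symm ⁻¹' U) :=
    (continuousOn_extChartAt_symm x).isOpen_inter_preimage (isOpen_extChartAt_target x) hU
  have hmem : ψ x ∈ ψ.target ∩ ψ.symm ⁻¹' U :=
    ⟨mem_extChartAt_target x, by simpa [ψ, extChartAt_to_inv] using hx⟩
  obtain ⟨ε, hε, hball⟩ := Metric.isOpen_iff.1 hopen _ hmem
  have hd : ∀ z ∈ Metric.ball (ψ x) ε, HasFDerivAt (g ∘ ψ.symm) (0 : E →L[ℝ] ℝ) z := by
    intro z hz
    have h1 : MDifferentiableAt 𝓘(ℝ, E) I ψ.symm z :=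
      ((contMDiffOn_extChartAt_symm (n := 1) x).contMDiffAt
        ((isOpen_extChartAt_target x).mem_nhds (hball hz).1)).mdifferentiableAt (by simp)
    have h2 : HasMFDerivAt I 𝓘(ℝ) g (ψ.symm z) 0 := by
      have h3 := (hg _ (hball hz).2).hasMFDerivAt
      have h4 : mfderiv I 𝓘(ℝ) g (ψ.symm z) = 0 := h _ (hball hz).2
      rwa [h4] at h3
    have h5 := h2.comp z h1.hasMFDerivAt
    rw [ContinuousLinearMap.zero_comp] at h5
    exact h5.hasFDerivAt
  have hconst : ∀ z ∈ Metric.ball (ψ x) ε, (g ∘ ψ.symm) z = (g ∘ ψ.symm) (ψ x) := fun z hz ↦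
    Metric.isOpen_ball.is_const_of_fderiv_eq_zero (convex_ball _ _).isPreconnected
      (fun w hw ↦ (hd w hw).differentiableAt.differentiableWithinAt)
      (fun w hw ↦ (hd w hw).fderiv) hz (Metric.mem_ball_self hε)
  filter_upwards [(continuousAt_extChartAt (I := I) x).preimage_mem_nhds (Metric.ball_mem_nhds _ hε),
    extChartAt_source_mem_nhds (I := I) x] with y hy hys
  have h6 := hconst _ hy
  rwa [Function.comp_apply, Function.comp_apply, (extChartAt I x).left_inv hys,
    extChartAt_to_inv] at h6

namespace ContactMetricStructure

namespace IsAdaptedFrameWith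

variable {M : Type*} [TopologicalSpace M] [T2Space M]
  [ChartedSpace (EuclideanSpace ℝ (Fin 3)) M] [IsManifold (𝓡 3) ∞ M]
  [RiemannianBundle (fun x : M ↦ TangentSpace (𝓡 3) x)]
  [IsContMDiffRiemannianBundle (𝓡 3) ∞ (EuclideanSpace ℝ (Fin 3))
    (fun x : M ↦ TangentSpace (𝓡 3) x)]
  {S : ContactMetricStructure M} {e f : Π x : M, TangentSpace (𝓡 3) x} {U : Set M} {x y : M}
  {nabla : CovariantDerivative (𝓡 3) (EuclideanSpace ℝ (Fin 3))
    (TangentSpace (𝓡 3) : M → Type _)}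
  {a b c p q r s κ μ g : M → ℝ}

/-- Adding the diagonal components of R(·,ξ)ξ in the directions e and f cancels μ, a and, by s = -p,
the derivative of p. This is Ric(ξ,ξ) = 2κ = 2 - tr h². -/
theorem κ_eq (F : S.IsAdaptedFrameWith nabla e f U a b c p q r s)
    (hn : IsLeviCivita nabla) (hS : S.IsKappaMu nabla κ μ) (hy : y ∈ U) :
    κ y = 1 - p y ^ 2 - (q y + 1) ^ 2 := by
  obtain ⟨h1, -⟩ := F.curvature_e_ξ hn hS hy
  have h2 := F.curvature_f_ξ hn hS hy
  have hs : s =ᶠ[𝓝 y] fun z ↦ -p z := (F.eventually_mem hy).mono fun z hz ↦ (F.jacobi hn hz).2.2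
  rw [derivAlong_congr hs, derivAlong_fun_neg, hs.self_of_nhds, F.r_eq y hy] at h2
  rw [F.r_eq y hy] at h1
  linarith

/-- The relations between `κ`, `μ` and the connection coefficients in a frame of eigenvectors of
`h`, where the eigenvalues of `h` do not vanish. -/
theorem eigenframe_relations (F : S.IsAdaptedFrameWith nabla e f U a b c p q r s)
    (hn : IsLeviCivita nabla) (hS : S.IsKappaMu nabla κ μ) (hp : ∀ z ∈ U, p z = 0)
    (hq : ∀ z ∈ U, q z + 1 ≠ 0) (hy : y ∈ U) :
    μ y = -2 * a y ∧ derivAlong (𝓡 3) S.ξ q y = 0 ∧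
      derivAlong (𝓡 3) e a y = -derivAlong (𝓡 3) e q y ∧
      derivAlong (𝓡 3) f a y = derivAlong (𝓡 3) f q y := by
  have hs {z : M} (hz : z ∈ U) : s z = 0 := by rw [(F.jacobi hn hz).2.2, hp z hz, neg_zero]
  have dp {z : M} (hz : z ∈ U) (X : Π x : M, TangentSpace (𝓡 3) x) :
      derivAlong (𝓡 3) X p z = 0 :=
    derivAlong_eq_zero_of_eventually_eq_const ((F.eventually_mem hz).mono hp)
  have ds {z : M} (hz : z ∈ U) (X : Π x : M, TangentSpace (𝓡 3) x) :
      derivAlong (𝓡 3) X s z = 0 :=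
    derivAlong_eq_zero_of_eventually_eq_const ((F.eventually_mem hz).mono fun w hw ↦ hs hw)
  have hξ {z : M} (hz : z ∈ U) : derivAlong (𝓡 3) S.ξ q z = 0 := by
    have h := (F.curvature_e_ξ hn hS hz).2
    rw [hp z hz, hs hz] at h
    linarith
  have he {z : M} (hz : z ∈ U) : derivAlong (𝓡 3) e q z = (2 * c z) * (q z + 1) := by
    have h := (F.curvature_e_f hn hS hz).1
    rw [hp z hz, hs hz, dp hz, F.r_eq z hz] at h
    linarith
  have hf {z : M} (hz : z ∈ U) : derivAlong (𝓡 3) f q z = (2 * b z) * (q z + 1) := by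
    have h := (F.curvature_e_f hn hS hz).2
    rw [hp z hz, hs hz, ds hz, F.r_eq z hz] at h
    linarith
  have dprod {k : M → ℝ} (hk : ContMDiff (𝓡 3) 𝓘(ℝ) ∞ k) :
      derivAlong (𝓡 3) S.ξ (fun z ↦ (2 * k z) * (q z + 1)) y
        = 2 * (q y + 1) * derivAlong (𝓡 3) S.ξ k y := by
    have m2 (t : ℝ) : MDifferentiableAt (𝓡 3) 𝓘(ℝ) (fun _ : M ↦ t) y := mdifferentiableAt_const
    have d2 (t : ℝ) : derivAlong (𝓡 3) S.ξ (fun _ : M ↦ t) y = 0 :=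
      derivAlong_eq_zero_of_eventually_eq_const (c := t) (by simp)
    have mk := mdifferentiableAt_of_contMDiff hk y
    have mq := mdifferentiableAt_of_contMDiff F.smooth_q y
    have m3 : MDifferentiableAt (𝓡 3) 𝓘(ℝ) (fun z ↦ 2 * k z) y := (m2 2).mul mk
    have m4 : MDifferentiableAt (𝓡 3) 𝓘(ℝ) (fun z ↦ q z + 1) y := mq.add (m2 1)
    rw [derivAlong_fun_mul m3 m4, derivAlong_fun_mul (m2 2) mk,
      derivAlong_fun_add mq (m2 1), d2, d2, hξ hy]
    ring
  -- As ξq = 0 on U, the commutators [e,ξ]q and [f,ξ]q reduce to -ξ(eq) and -ξ(fq). Inserting eq =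
  -- 2c(q+1), fq = 2b(q+1) and dividing by q + 1 yields ξc and ξb.
  have dξ0 (X : Π x : M, TangentSpace (𝓡 3) x) :
      derivAlong (𝓡 3) X (derivAlong (𝓡 3) S.ξ q) y = 0 :=
    derivAlong_eq_zero_of_eventually_eq_const ((F.eventually_mem hy).mono fun z hz ↦ hξ hz)
  have hc : derivAlong (𝓡 3) S.ξ c y = -(q y - a y) * b y := by
    have h := F.derivAlong_comm_e_ξ hn F.smooth_q hy
    rw [dξ0, derivAlong_congr ((F.eventually_mem hy).mono fun z hz ↦ he hz), dprod F.smooth_c,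
      hf hy, hp y hy] at h
    apply mul_left_cancel₀ (hq y hy)
    linarith
  have hb : derivAlong (𝓡 3) S.ξ b y = -(r y + a y) * c y := by
    have h := F.derivAlong_comm_f_ξ hn F.smooth_q hy
    rw [dξ0, derivAlong_congr ((F.eventually_mem hy).mono fun z hz ↦ hf hz), dprod F.smooth_b,
      he hy, hs hy] at h
    apply mul_left_cancel₀ (hq y hy)
    linarith
  -- Those values of ξb and ξc cancel the b and c terms of the Jacobi identity, leaving only
  -- derivatives of a and q.
  obtain ⟨j1, j2, -⟩ := F.jacobi hn hy
  rw [hs hy, hb, dp hy] at j1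
  rw [hp y hy, hc, ds hy] at j2
  refine ⟨?_, hξ hy, by linarith, by linarith⟩
  have h1 := (F.curvature_e_ξ hn hS hy).1
  rw [F.κ_eq hn hS hy, hp y hy, dp hy, F.r_eq y hy] at h1
  apply mul_left_cancel₀ (hq y hy)
  linarith

/-- Constant κ makes q constant, hence ea = fa = 0; the contact condition supplies the missing
direction, and μ = -2a. -/
theorem eventually_μ_eq (F : S.IsAdaptedFrameWith nabla e f U a b c p q r s)
    (hn : IsLeviCivita nabla) (hS : S.IsKappaMu nabla κ μ) (hp : ∀ z ∈ U, p z = 0)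
    (hq : ∀ z ∈ U, q z + 1 ≠ 0) {k : ℝ} (hκ : ∀ z ∈ U, κ z = k) (hx : x ∈ U) :
    ∀ᶠ y in 𝓝 x, μ y = μ x := by
  have R {y : M} (hy : y ∈ U) := F.eigenframe_relations hn hS hp hq hy
  have dq {y : M} (hy : y ∈ U) (X : Π x : M, TangentSpace (𝓡 3) x) :
      derivAlong (𝓡 3) X q y = 0 := by
    -- With p = 0, κ = 1 - (q+1)² = -2q - q², whose derivative has the nonzero factor -2(q+1).
    have h1 : derivAlong (𝓡 3) X (fun z ↦ 0 + (-2) * q z + (-1) * (q z * q z)) y = 0 := by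
      refine derivAlong_eq_zero_of_eventually_eq_const (c := k) ?_
      refine (F.eventually_mem hy).mono fun z hz ↦ ?_
      rw [← hκ z hz, F.κ_eq hn hS hz, hp z hz]
      ring
    rw [derivAlong_quadratic (mdifferentiableAt_of_contMDiff F.smooth_q y)] at h1
    refine (mul_eq_zero.1 h1).resolve_left fun h2 ↦ hq y hy ?_
    linarith
  have ea {y : M} (hy : y ∈ U) : derivAlong (𝓡 3) e a y = 0 := by
    rw [(R hy).2.2.1, dq hy, neg_zero]
  have fa {y : M} (hy : y ∈ U) : derivAlong (𝓡 3) f a y = 0 := by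
    rw [(R hy).2.2.2, dq hy]
  have da : ∀ y ∈ U, mvfderiv (𝓡 3) a y = 0 := by
    intro y hy
    refine F.toIsAdaptedFrame.mvfderiv_eq_zero hy (ea hy) (fa hy) ?_
    -- The bracket [e,f] has ξ-component 2, so vanishing of ea and fa on all of U forces ξa = 0.
    have h := F.derivAlong_comm_e_f hn F.smooth_a hy
    rw [ea hy, fa hy, derivAlong_eq_zero_of_eventually_eq_const (c := 0)
      ((F.eventually_mem hy).mono fun z hz ↦ fa hz),
      derivAlong_eq_zero_of_eventually_eq_const (c := 0)
      ((F.eventually_mem hy).mono fun z hz ↦ ea hz)] at h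
    linarith
  have : IsManifold (𝓡 3) 1 M := .of_le (n := ∞) (by simp)
  filter_upwards [F.eventually_mem hx, eventually_eq_of_mvfderiv_eq_zero F.isOpen hx
    (fun y _ ↦ mdifferentiableAt_of_contMDiff F.smooth_a y) da] with y hy hay
  rw [(R hy).1, (R hx).1, hay]

/-- Constant μ = -2a kills the derivatives of a, hence eq and fq; ξq = 0 holds anyway, and κ depends
on q alone. -/
theorem eventually_κ_eq (F : S.IsAdaptedFrameWith nabla e f U a b c p q r s)
    (hn : IsLeviCivita nabla) (hS : S.IsKappaMu nabla κ μ) (hp : ∀ z ∈ U, p z = 0)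
    (hq : ∀ z ∈ U, q z + 1 ≠ 0) {k : ℝ} (hμ : ∀ z ∈ U, μ z = k) (hx : x ∈ U) :
    ∀ᶠ y in 𝓝 x, κ y = κ x := by
  have R {y : M} (hy : y ∈ U) := F.eigenframe_relations hn hS hp hq hy
  have da {y : M} (hy : y ∈ U) (X : Π x : M, TangentSpace (𝓡 3) x) :
      derivAlong (𝓡 3) X a y = 0 := by
    refine derivAlong_eq_zero_of_eventually_eq_const (c := -k / 2) ?_
    refine (F.eventually_mem hy).mono fun z hz ↦ ?_
    have h1 := (R hz).1
    rw [hμ z hz] at h1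
    linarith
  have dq : ∀ y ∈ U, mvfderiv (𝓡 3) q y = 0 := by
    intro y hy
    obtain ⟨-, hξ, he, hf⟩ := R hy
    rw [da hy] at he hf
    exact F.toIsAdaptedFrame.mvfderiv_eq_zero hy (by linarith) (by linarith) hξ
  have : IsManifold (𝓡 3) 1 M := .of_le (n := ∞) (by simp)
  filter_upwards [F.eventually_mem hx, eventually_eq_of_mvfderiv_eq_zero F.isOpen hx
    (fun y _ ↦ mdifferentiableAt_of_contMDiff F.smooth_q y) dq] with y hy hqy
  rw [F.κ_eq hn hS hy, F.κ_eq hn hS hx, hqy, hp y hy, hp x hx]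

end IsAdaptedFrameWith

end ContactMetricStructure

/-! ### Existence of adapted frames and of eigenframes of h. -/

/-- Near a point where `p` and `α` do not both vanish, the double angle equation
`(u² - v²) p = 2 u v α` has a smooth nontrivial solution. -/
theorem exists_contMDiffOn_doubleAngle {E : Type*} [NormedAddCommGroup E] [NormedSpace ℝ E]
    {H : Type*} [TopologicalSpace H] {I : ModelWithCorners ℝ E H} {M : Type*} [TopologicalSpace M]
    [ChartedSpace H M] {p α : M → ℝ} {x : M}
    (hp : ContMDiff I 𝓘(ℝ) ∞ p)
    (hα : ContMDiff I 𝓘(ℝ) ∞ α) (hx : p x ^ 2 + α x ^ 2 ≠ 0) :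
    ∃ (V : Set M) (u v : M → ℝ), IsOpen V ∧ x ∈ V ∧ ContMDiffOn I 𝓘(ℝ) ∞ u V ∧
      ContMDiffOn I 𝓘(ℝ) ∞ v V ∧
      ∀ y ∈ V, (u y ^ 2 - v y ^ 2) * p y = 2 * u y * v y * α y ∧ u y ^ 2 + v y ^ 2 ≠ 0 := by
  have hsq : ContMDiff I 𝓘(ℝ) ∞ (fun y ↦ p y ^ 2 + α y ^ 2) := (hp.pow 2).add (hα.pow 2)
  set l : M → ℝ := fun y ↦ √(p y ^ 2 + α y ^ 2) with hl
  have hlsq (y : M) : l y ^ 2 = p y ^ 2 + α y ^ 2 := Real.sq_sqrt (by positivity)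
  have hlc : Continuous l := hsq.continuous.sqrt
  have hls : ContMDiffOn I 𝓘(ℝ) ∞ l {y | p y ^ 2 + α y ^ 2 ≠ 0} := fun y hy ↦
    (Real.contDiffAt_sqrt (n := ∞) hy).comp_contMDiffWithinAt
      (f := fun y ↦ p y ^ 2 + α y ^ 2) (hsq y).contMDiffWithinAt
  have hopen : IsOpen {y | p y ^ 2 + α y ^ 2 ≠ 0} := isOpen_ne_fun hsq.continuous continuous_const
  have hlx : 0 < l x := Real.sqrt_pos.2 (lt_of_le_of_ne (by positivity) hx.symm)
  -- Both (α + l, p) and (p, l - α) solve (α - l)u + pv = 0 and pu = (α + l)v, the eigenvector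
  -- equations of the symmetric matrix with rows (α, p), (p, -α) for the eigenvalue l. The sign of α
  -- at x decides which of them cannot vanish there.
  rcases le_total 0 (α x) with h | h
  · refine ⟨{y | p y ^ 2 + α y ^ 2 ≠ 0} ∩ {y | α y + l y ≠ 0}, fun y ↦ α y + l y, p,
      hopen.inter (isOpen_ne_fun (hα.continuous.add hlc) continuous_const), ⟨hx, ?_⟩,
      (hα.contMDiffOn.add hls).mono Set.inter_subset_left, hp.contMDiffOn, fun y hy ↦ ⟨?_, ?_⟩⟩
    · exact (by linarith : 0 < α x + l x).ne'
    · linear_combination (p y) * hlsq y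
    · have := sq_pos_of_ne_zero hy.2
      positivity
  · refine ⟨{y | p y ^ 2 + α y ^ 2 ≠ 0} ∩ {y | l y - α y ≠ 0}, p, fun y ↦ l y - α y,
      hopen.inter (isOpen_ne_fun (hlc.sub hα.continuous) continuous_const), ⟨hx, ?_⟩,
      hp.contMDiffOn, (hls.sub hα.contMDiffOn).mono Set.inter_subset_left, fun y hy ↦ ⟨?_, ?_⟩⟩
    · exact (by linarith : 0 < l x - α x).ne'
    · linear_combination (-p y) * hlsq y
    · have := sq_pos_of_ne_zero hy.2
      positivity

namespace ContactMetricStructure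

variable {M : Type*} [TopologicalSpace M] [T2Space M]
  [ChartedSpace (EuclideanSpace ℝ (Fin 3)) M] [IsManifold (𝓡 3) ∞ M]
  [RiemannianBundle (fun x : M ↦ TangentSpace (𝓡 3) x)]
  [IsContMDiffRiemannianBundle (𝓡 3) ∞ (EuclideanSpace ℝ (Fin 3))
    (fun x : M ↦ TangentSpace (𝓡 3) x)]
  {x : M} {U : Set M} {κ μ : M → ℝ}
  {nabla : CovariantDerivative (𝓡 3) (EuclideanSpace ℝ (Fin 3))
    (TangentSpace (𝓡 3) : M → Type _)}

/-- A nonvanishing smooth field orthogonal to the Reeb field can be normalised to the first field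
of an adapted frame. -/
theorem exists_isAdaptedFrame_of_field (S : ContactMetricStructure M)
    {W : Π x : M, TangentSpace (𝓡 3) x} (hU : IsOpen U) (hx : x ∈ U)
    (hW : ContMDiffOn (𝓡 3) (𝓡 3).tangent ∞ (fun y ↦ (⟨y, W y⟩ : TangentBundle (𝓡 3) M)) U)
    (hξ : ∀ y ∈ U, inner ℝ (S.ξ y) (W y) = 0) (h0 : ∀ y ∈ U, W y ≠ 0) :
    ∃ e f, ∃ V ⊆ U, S.IsAdaptedFrame e f V ∧ x ∈ V ∧ ∀ y ∈ V, ∃ m : ℝ, e y = m • W y := by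
  have hn : ContMDiffOn (𝓡 3) 𝓘(ℝ) ∞ (fun y ↦ inner ℝ (W y) (W y)) U :=
    ContMDiffOn.inner_bundle (F := EuclideanSpace ℝ (Fin 3)) (b := id) hW hW
  have hpos : ∀ y ∈ U, 0 < inner ℝ (W y) (W y) := fun y hy ↦ real_inner_self_pos.2 (h0 y hy)
  have hm : ContMDiffOn (𝓡 3) 𝓘(ℝ) ∞ (fun y ↦ (√(inner ℝ (W y) (W y)))⁻¹) U := by
    intro y hy
    have h1 : ContDiffAt ℝ ∞ (fun t : ℝ ↦ (√t)⁻¹) (inner ℝ (W y) (W y)) :=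
      (Real.contDiffAt_sqrt (hpos y hy).ne').inv (Real.sqrt_pos.2 (hpos y hy)).ne'
    exact h1.comp_contMDiffWithinAt (f := fun y ↦ inner ℝ (W y) (W y)) (hn y hy)
  obtain ⟨e, he, heW⟩ := exists_isSmoothVectorField_eventuallyEq hU hx
    (X := (fun y ↦ (√(inner ℝ (W y) (W y)))⁻¹) • W) (ContMDiffOn.smul_section hm hW)
  obtain ⟨V, hVsub, hV, hxV⟩ := mem_nhds_iff.1 (Filter.inter_mem (hU.mem_nhds hx) heW)
  have heV : ∀ y ∈ V, e y = (√(inner ℝ (W y) (W y)))⁻¹ • W y := fun y hy ↦ (hVsub hy).2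
  refine ⟨e, fun y ↦ S.φ y (e y), V, fun y hy ↦ (hVsub hy).1, ⟨hV, he, fun _ ↦ rfl, ?_, ?_⟩, hxV,
    fun y hy ↦ ⟨_, heV y hy⟩⟩
  · intro y hy
    have h2 := hpos y (hVsub hy).1
    rw [heV y hy, real_inner_smul_left, real_inner_smul_right, ← mul_assoc, ← mul_inv,
      Real.mul_self_sqrt h2.le, inv_mul_cancel₀ h2.ne']
  · intro y hy
    rw [heV y hy, real_inner_smul_right, hξ y (hVsub hy).1, mul_zero]

/-- Dimension three provides a vector not proportional to ξ; its extension, projected orthogonally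
to ξ, is nonzero near x. -/
theorem exists_isAdaptedFrame (S : ContactMetricStructure M) (x : M) :
    ∃ e f U, S.IsAdaptedFrame e f U ∧ x ∈ U := by
  obtain ⟨v, hv⟩ : ∃ v : TangentSpace (𝓡 3) x, ∀ t : ℝ, t • S.ξ x ≠ v := by
    by_contra! h
    have h1 : Module.finrank ℝ (TangentSpace (𝓡 3) x) ≤ 1 := finrank_le_one (S.ξ x) h
    have h3 : Module.finrank ℝ (TangentSpace (𝓡 3) x) = 3 :=
      (finrank_euclideanSpace_fin : Module.finrank ℝ (EuclideanSpace ℝ (Fin 3)) = 3)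
    omega
  obtain ⟨X, hX, rfl⟩ := exists_isSmoothVectorField_apply_eq v
  have hc := (S.smooth_ξ.inner hX).neg
  set W := X + (fun y ↦ -inner ℝ (S.ξ y) (X y)) • S.ξ with hWdef
  have hW : IsSmoothVectorField (𝓡 3) W := hX.add (S.smooth_ξ.smul hc)
  have hξ (y : M) : inner ℝ (S.ξ y) (W y) = 0 := by
    simp [hWdef, inner_add_right, real_inner_smul_right, -inner_self_eq_norm_sq_to_K, S.norm_ξ y]
  have hopen : IsOpen {y | inner ℝ (W y) (W y) ≠ 0} :=
    isOpen_ne_fun (hW.inner hW).continuous continuous_const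
  have hWx : W x ≠ 0 := by
    intro h
    apply hv (inner ℝ (S.ξ x) (X x))
    have h' : X x + (-inner ℝ (S.ξ x) (X x)) • S.ξ x = 0 := h
    rw [neg_smul, ← sub_eq_add_neg, sub_eq_zero] at h'
    exact h'.symm
  obtain ⟨e, f, V, -, F, hxV, -⟩ := S.exists_isAdaptedFrame_of_field hopen
    (x := x) (W := W) (by simpa using hWx) hW.contMDiffOn (fun y _ ↦ hξ y)
    (fun y hy h ↦ hy (by rw [h, inner_zero_left]))
  exact ⟨e, f, V, F, hxV⟩

/-- Near a point with `κ < 1` there is an adapted frame of eigenvectors of `h`. -/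
theorem exists_eigenframe {S : ContactMetricStructure M} (hn : IsLeviCivita nabla)
    (hS : S.IsKappaMu nabla κ μ) (hx : κ x < 1) :
    ∃ (e f : Π x : M, TangentSpace (𝓡 3) x) (U : Set M) (a b c p q r s : M → ℝ),
      S.IsAdaptedFrameWith nabla e f U a b c p q r s ∧ x ∈ U ∧ (∀ y ∈ U, p y = 0) ∧
      ∀ y ∈ U, q y + 1 ≠ 0 := by
  obtain ⟨e, f, U, F₀, hxU⟩ := S.exists_isAdaptedFrame x
  have F := F₀.isAdaptedFrameWith hn
  set p := fun y ↦ inner ℝ (nabla S.ξ y (e y)) (e y)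
  set q := fun y ↦ inner ℝ (nabla S.ξ y (e y)) (f y)
  -- For W = ue + vf, g(∇_Wξ, W) = (u² - v²)p + 2uv(q+1). The new p vanishes when this does, which
  -- is the double angle equation with α = -(q+1).
  have hα : ContMDiff (𝓡 3) 𝓘(ℝ) ∞ (fun y ↦ -(q y + 1)) := (F.smooth_q.add contMDiff_const).neg
  obtain ⟨V, u, v, hV, hxV, hu, hv, huv⟩ := exists_contMDiffOn_doubleAngle (x := x) F.smooth_p hα
    (fun h ↦ by linarith [F.κ_eq hn hS hxU, neg_sq (q x + 1)])
  have hW : ContMDiffOn (𝓡 3) (𝓡 3).tangent ∞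
      (fun y ↦ (⟨y, (u • e + v • f) y⟩ : TangentBundle (𝓡 3) M))
      (U ∩ V ∩ {y | p y ^ 2 + (q y + 1) ^ 2 ≠ 0}) :=
    (ContMDiffOn.add_section (ContMDiffOn.smul_section hu F.smooth.contMDiffOn)
      (ContMDiffOn.smul_section hv F.smooth_right.contMDiffOn)).mono
        fun y hy ↦ hy.1.2
  have hopen : IsOpen (U ∩ V ∩ {y | p y ^ 2 + (q y + 1) ^ 2 ≠ 0}) :=
    (F.isOpen.inter hV).inter (isOpen_ne_fun ((F.smooth_p.continuous.pow 2).add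
      ((F.smooth_q.continuous.add continuous_const).pow 2)) continuous_const)
  obtain ⟨e', f', V', hV', F', hxV', he'⟩ := S.exists_isAdaptedFrame_of_field hopen (x := x)
    ⟨⟨hxU, hxV⟩, fun h ↦ by linarith [F.κ_eq hn hS hxU]⟩ hW
    (fun y hy ↦ by
      simp [inner_add_right, real_inner_smul_right, F.inner_ξ y hy.1.1, F.inner_ξ_right y])
    (fun y hy h ↦ by
      obtain ⟨h1, h2, -⟩ := F.coeff_eq hy.1.1 (a := u y) (b := v y) (c := 0) (a' := 0) (b' := 0)
        (c' := 0) (by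
          have h' : u y • e y + v y • f y = 0 := h
          rw [h']
          module)
      exact (huv y hy.1.2).2 (by rw [h1, h2]; norm_num))
  have G := F'.isAdaptedFrameWith hn
  have hp' : ∀ y ∈ V', inner ℝ (nabla S.ξ y (e' y)) (e' y) = 0 := by
    intro y hy
    have hyU : y ∈ U := (hV' hy).1.1
    obtain ⟨m, hm⟩ := he' y hy
    have hm' : e' y = m • (u y • e y + v y • f y) := hm
    have h1 := (huv y (hV' hy).1.2).1
    rw [hm', map_smul, map_add, map_smul, map_smul, F.nabla_ξ_e y hyU, F.nabla_ξ_f y hyU,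
      F.r_eq y hyU, (F.jacobi hn hyU).2.2]
    simp only [inner_add_left, inner_add_right, real_inner_smul_left, real_inner_smul_right,
      F.inner_self y hyU, F.inner_right hyU, F.inner_left_right y,
      real_inner_comm (e y) (f y)]
    linear_combination (m ^ 2) * h1
  -- The formula for κ holds in both frames: if the new q + 1 vanished, κ would be 1, contrary to p²
  -- + (q+1)² ≠ 0 in the old frame.
  refine ⟨e', f', V', _, _, _, _, _, _, _, G, hxV', hp', fun y hy h ↦ ?_⟩
  have h1 := G.κ_eq hn hS hy
  rw [hp' y hy, h] at h1
  have h2 := F.κ_eq hn hS (hV' hy).1.1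
  apply (hV' hy).2
  linarith

/-! ### Global properties of κ and the connectedness argument. -/

/-- No regularity of κ is assumed; it comes from the local formula for κ in smooth connection
coefficients. -/
theorem IsKappaMu.continuous {S : ContactMetricStructure M} (hS : S.IsKappaMu nabla κ μ)
    (hn : IsLeviCivita nabla) : Continuous κ := by
  refine continuous_iff_continuousAt.2 fun x ↦ ?_
  obtain ⟨e, f, U, F₀, hxU⟩ := S.exists_isAdaptedFrame x
  have F := F₀.isAdaptedFrameWith hn
  refine ContinuousAt.congr ?_ ((F.eventually_mem hxU).mono fun y hy ↦ (F.κ_eq hn hS hy).symm)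
  exact ((continuous_const.sub (F.smooth_p.continuous.pow 2)).sub
    ((F.smooth_q.continuous.add continuous_const).pow 2)).continuousAt

theorem IsKappaMu.le_one {S : ContactMetricStructure M} (hS : S.IsKappaMu nabla κ μ)
    (hn : IsLeviCivita nabla) (x : M) : κ x ≤ 1 := by
  obtain ⟨e, f, U, F₀, hxU⟩ := S.exists_isAdaptedFrame x
  have F := F₀.isAdaptedFrameWith hn
  rw [F.κ_eq hn hS hxU]
  nlinarith [sq_nonneg (inner ℝ (nabla S.ξ x (e x)) (e x)),
    sq_nonneg (inner ℝ (nabla S.ξ x (e x)) (f x) + 1)]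

theorem IsKappaMu.eventually_μ_eq {S : ContactMetricStructure M} (hS : S.IsKappaMu nabla κ μ)
    (hn : IsLeviCivita nabla) {k : ℝ} (hκ : ∀ y, κ y = k) (hx : κ x < 1) :
    ∀ᶠ y in 𝓝 x, μ y = μ x := by
  obtain ⟨e, f, U, a, b, c, p, q, r, s, F, hxU, hp, hq⟩ := exists_eigenframe hn hS hx
  exact F.eventually_μ_eq hn hS hp hq (fun y _ ↦ hκ y) hxU

theorem IsKappaMu.eventually_κ_eq {S : ContactMetricStructure M} (hS : S.IsKappaMu nabla κ μ)
    (hn : IsLeviCivita nabla) {k : ℝ} (hμ : ∀ y, μ y = k) (hx : κ x < 1) :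
    ∀ᶠ y in 𝓝 x, κ y = κ x := by
  obtain ⟨e, f, U, a, b, c, p, q, r, s, F, hxU, hp, hq⟩ := exists_eigenframe hn hS hx
  exact F.eventually_κ_eq hn hS hp hq (fun y _ ↦ hμ y) hxU

/-- A level set of κ below 1 is closed by continuity and open because κ is locally constant where κ
< 1. If there is no such level, the bound κ ≤ 1 is attained everywhere. -/
theorem IsKappaMu.exists_κ_eq [ConnectedSpace M] {S : ContactMetricStructure M}
    (hS : S.IsKappaMu nabla κ μ) (hn : IsLeviCivita nabla) {k : ℝ} (hμ : ∀ y, μ y = k) :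
    ∃ c, ∀ x, κ x = c := by
  by_cases h : ∃ x, κ x < 1
  · obtain ⟨x, hx⟩ := h
    have hclopen : IsClopen {y | κ y = κ x} :=
      ⟨isClosed_eq (hS.continuous hn) continuous_const, isOpen_iff_mem_nhds.2 fun y hy ↦ by
        have hy' : κ y = κ x := hy
        filter_upwards [hS.eventually_κ_eq hn hμ (hy'.trans_lt hx)] with z hz
        exact hz.trans hy'⟩
    have huniv := hclopen.eq_univ ⟨x, rfl⟩
    exact ⟨κ x, Set.eq_univ_iff_forall.1 huniv⟩
  · push Not at h
    exact ⟨1, fun y ↦ le_antisymm (hS.le_one hn y) (h y)⟩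

end ContactMetricStructure

theorem mainTheorem3 {M : Type*} [TopologicalSpace M] [T2Space M] [ConnectedSpace M]
    [ChartedSpace (EuclideanSpace ℝ (Fin 3)) M] [IsManifold (𝓡 3) ∞ M]
    [RiemannianBundle (fun x : M ↦ TangentSpace (𝓡 3) x)]
    [IsContMDiffRiemannianBundle (𝓡 3) ∞ (EuclideanSpace ℝ (Fin 3))
      (fun x : M ↦ TangentSpace (𝓡 3) x)]
    (nabla : CovariantDerivative (𝓡 3) (EuclideanSpace ℝ (Fin 3))
      (TangentSpace (𝓡 3) : M → Type _))
    (hnabla : IsLeviCivita nabla)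
    (S : ContactMetricStructure M) (κ μ : M → ℝ) (hS : S.IsKappaMu nabla κ μ) :
    ((∀ x, κ x < 1) → ((∃ c, ∀ x, κ x = c) ↔ (∃ c, ∀ x, μ x = c))) ∧
    ((∀ x, μ x = 0) → ∃ c, ∀ x, κ x = c) := by
  refine ⟨fun hκ ↦ ⟨fun ⟨k, hk⟩ ↦ ?_, fun ⟨k, hk⟩ ↦ hS.exists_κ_eq hnabla hk⟩,
    fun hμ ↦ hS.exists_κ_eq hnabla hμ⟩
  -- Here κ < 1 is needed at every point: μ is not known to be continuous, so local constancy
  -- everywhere takes the place of a clopen argument.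
  have hloc : IsLocallyConstant μ := (IsLocallyConstant.iff_eventually_eq μ).2 fun x ↦
    hS.eventually_μ_eq hnabla hk (hκ x)
  obtain ⟨x₀⟩ := (inferInstance : Nonempty M)
  exact ⟨μ x₀, fun x ↦ hloc.apply_eq_of_isPreconnected isPreconnected_univ (Set.mem_univ _)
    (Set.mem_univ _)⟩
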